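/- **Model.** Let $r>0$, $c_T>0$, $r\neq c_T$, $0<x^*<B$, $\lambda>0$, $\delta\ge 0$, and put $x^{**}=\dfrac{c_TB-rx^*}{r-c_T}$. Let $G_Z$ be a probability law carried by $(0,1]$. For initial capital $X_0=x>0$, the capital process $X$ follows $$\frac{dX_t}{dt}=r\,[X_t-x^*]^+ + c_T\,[B-X_t]^+$$ between the events of a Poisson process of intensity $\lambda$, and at the $i$-th event it is multiplied by $Z_i$, where $Z_1,Z_2,\dots$ are i.i.d. with law $G_Z$ and independent of the Poisson process. Let $\omega:(0,x^*]\to[0,\infty)$ be non-increasing (hence locally bounded). The time of extreme poverty $\tau_x$ is the killing time of $X$ at rate $\omega(X_s)\mathbf 1_{\{X_s<x^*\}}$, i.e. $$\tau_x=\inf\Big\{t\ge0:\int_0^t\omega(X_s)\mathbf 1_{\{X_s<x^*\}}\,ds\ge \mathcal E\Big\},\qquad \inf\emptyset=\infty,$$ where $\mathcal E$ is a unit exponential variable independent of $X$. Let $w(x_1,x_2)$ be a measurable penalty function that is non-negative and bounded for $0<x_1,x_2<x^*$, and let $$m_\delta(x)=\mathbb E\Big[w\big(X_{\tau_x-},|X_{\tau_x}-x^*|\big)e^{-\delta\tau_x}\mathbf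 1_{\{\tau_x<\infty\}}\Big],\qquad x>0.$$ Write $m_{\delta,u}$, $m_{\delta,m}$, $m_{\delta,l}$ for the restrictions of $m_\delta$ to $[B,\infty)$, $[x^*,B)$ and $(0,x^*)$. **Theorem.** All the expectations and integrals below are those of integrable functions, and the following hold. 1. For every $x\ge B$, $m_{\delta,u}$ is differentiable at $x$ (from the right if $x=B$) and $$r(x-x^*)m_{\delta,u}'(x)-(\lambda+\delta)m_{\delta,u}(x)+\lambda\Big[\int_{(0,x^*/x)}m_{\delta,l}(xz)\,dG_Z(z)+\int_{[x^*/x,B/x)}m_{\delta,m}(xz)\,dG_Z(z)+\int_{[B/x,1]}m_{\delta,u}(xz)\,dG_Z(z)\Big]=0.$$ 2. For every $x^*\le x<B$, $m_{\delta,m}$ is differentiable at $x$ (from the right if $x=x^*$) and $$(r-c_T)(x+x^{**})m_{\delta,m}'(x)-(\lambda+\delta)m_{\delta,m}(x)+\lambda\Big[\int_{(0,x^*/x)}m_{\delta,l}(xz)\,dG_Z(z)+\int_{[x^*/x,1]}m_{\delta,m}(xz)\,dG_Z(z)\Big]=0.$$ 3. For every $0<x<x^*$ at which both $\omega$ and $v\mapsto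 w(v,x^*-v)$ are continuous, and also for Lebesgue-almost every $0<x<x^*$, $m_{\delta,l}$ is differentiable at $x$ and $$c_T(x-B)m_{\delta,l}'(x)+[\lambda+\delta+\omega(x)]m_{\delta,l}(x)-\omega(x)w(x,x^*-x)-\lambda\int_{(0,1]}m_{\delta,l}(xz)\,dG_Z(z)=0.$$ 4. $m_{\delta,u}(B)=m_{\delta,m}(B^-)$ and $m_{\delta,m}(x^*)=m_{\delta,l}(x^{*-})$, where $f(a^-)$ denotes the left limit of $f$ at $a$; and $\lim_{x\to\infty}m_{\delta,u}(x)=0$ provided that $\delta>0$ or the net profit condition $\lambda\,\mathbb E[-\log Z_1]<r$ holds. -/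

import Mathlib

open MeasureTheory ProbabilityTheory Filter Topology
open scoped ENNReal NNReal

noncomputable section

namespace Household

/-! ### Deterministic growth between capital losses -/

/-- Right-hand side of the capital dynamics
`dX/dt = r [X - x*]⁺ + c_T [B - X]⁺`. -/
def drift (r cT xs B y : ℝ) : ℝ := r * max (y - xs) 0 + cT * max (B - y) 0

/-- The constant `x** = (c_T B - r x*) / (r - c_T)`. -/
def xss (r cT xs B : ℝ) : ℝ := (cT * B - r * xs) / (r - cT)

/-- Growth from a capital level `y ≥ B`. -/
def growUp (r xs t y : ℝ) : ℝ := (y - xs) * Real.exp (r * t) + xs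

/-- Growth from a level `x* ≤ y < B`, as long as the barrier `B` is not reached. -/
def growMid (r cT xs B t y : ℝ) : ℝ :=
  (y + xss r cT xs B) * Real.exp ((r - cT) * t) - xss r cT xs B

/-- Growth from a level `0 < y < x*`, as long as the critical capital `x*` is not reached. -/
def growLow (cT B t y : ℝ) : ℝ := (y - B) * Real.exp (-cT * t) + B

/-- Time needed to grow from `y ∈ [x*, B)` to `B`. -/
def timeToB (r cT xs B y : ℝ) : ℝ :=
  1 / (r - cT) * Real.log ((B + xss r cT xs B) / (y + xss r cT xs B))

/-- Time needed to grow from `y ∈ (0, x*)` to `x*`. -/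
def timeToXs (cT xs B y : ℝ) : ℝ := -(1 / cT) * Real.log ((xs - B) / (y - B))

/-- Growth from a level `x* ≤ y < B`: first up to `B`, then above `B`. -/
def flowMid (r cT xs B t y : ℝ) : ℝ :=
  if t ≤ timeToB r cT xs B y then growMid r cT xs B t y
  else growUp r xs (t - timeToB r cT xs B y) B

/-- Growth from a level `0 < y < x*`: first up to `x*`, then above `x*`. -/
def flowLow (r cT xs B t y : ℝ) : ℝ :=
  if t ≤ timeToXs cT xs B y then growLow cT B t y
  else flowMid r cT xs B (t - timeToXs cT xs B y) xs

/-- Capital at time `t ≥ 0` when it starts at `y > 0` and no loss occurs: the solution of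
`dX/dt = drift X`, `X 0 = y` (see `flow_zero` and `hasDerivAt_flow`). -/
def flow (r cT xs B t y : ℝ) : ℝ :=
  if B ≤ y then growUp r xs t y
  else if xs ≤ y then flowMid r cT xs B t y
  else flowLow r cT xs B t y

/-! ### The flow solves the differential equation -/

theorem glue_ode (v f g : ℝ → ℝ) (a : ℝ) (ha : 0 ≤ a)
    (hf : ∀ t, 0 ≤ t → t ≤ a → HasDerivAt f (v (f t)) t)
    (hg : ∀ t, 0 ≤ t → HasDerivAt g (v (g t)) t) (hfg : f a = g 0) :
    ∀ t, 0 ≤ t → HasDerivAt (fun s => if s ≤ a then f s else g (s - a))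
      (v (if t ≤ a then f t else g (t - a))) t := by
  intro t ht
  have hg' : ∀ t, a ≤ t → HasDerivAt (fun s => g (s - a)) (v (g (t - a))) t := by
    intro t ht
    have := (hg (t - a) (by linarith)).comp_sub_const t a
    simpa using this
  rcases lt_trichotomy t a with h | h | h
  · rw [if_pos h.le]
    refine (hf t ht h.le).congr_of_eventuallyEq ?_
    filter_upwards [Iio_mem_nhds h] with s hs
    rw [if_pos (le_of_lt hs)]
  · subst h
    rw [if_pos le_rfl]
    have h1 : HasDerivWithinAt (fun s => if s ≤ t then f s else g (s - t))
        (v (f t)) (Set.Iic t) t := by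
      refine (hf t ht le_rfl).hasDerivWithinAt.congr (fun s hs => ?_) ?_
      · exact if_pos hs
      · exact if_pos le_rfl
    have h2 : HasDerivWithinAt (fun s => if s ≤ t then f s else g (s - t))
        (v (f t)) (Set.Ici t) t := by
      have h3 := (hg' t le_rfl).hasDerivWithinAt (s := Set.Ici t)
      rw [sub_self, ← hfg] at h3
      refine h3.congr (fun s hs => ?_) ?_
      · rcases eq_or_lt_of_le (show t ≤ s from hs) with h | h
        · subst h; simp [hfg]
        · exact if_neg (not_le.2 h)
      · simp [hfg]
    have := h1.union h2
    rwa [Set.Iic_union_Ici, hasDerivWithinAt_univ] at this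
  · rw [if_neg (not_le.2 h)]
    refine (hg' t h.le).congr_of_eventuallyEq ?_
    filter_upwards [Ioi_mem_nhds h] with s hs
    rw [if_neg (not_le.2 hs)]

section Flow

variable {r cT xs B : ℝ}

theorem drift_of_ge {y : ℝ} (hxB : xs < B) (h : B ≤ y) : drift r cT xs B y = r * (y - xs) := by
  unfold drift
  rw [max_eq_left (by linarith), max_eq_right (by linarith)]
  ring

theorem drift_of_mid {y : ℝ} (h1 : xs ≤ y) (h2 : y ≤ B) :
    drift r cT xs B y = r * (y - xs) + cT * (B - y) := by
  unfold drift
  rw [max_eq_left (by linarith), max_eq_left (by linarith)]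

theorem drift_of_le {y : ℝ} (hxB : xs < B) (h : y ≤ xs) :
    drift r cT xs B y = cT * (B - y) := by
  unfold drift
  rw [max_eq_right (by linarith), max_eq_left (by linarith)]
  ring

theorem mul_add_xss (hrc : r ≠ cT) (y : ℝ) :
    (r - cT) * (y + xss r cT xs B) = r * (y - xs) + cT * (B - y) := by
  have : r - cT ≠ 0 := sub_ne_zero.2 hrc
  unfold xss
  field_simp
  ring

theorem hasDerivAt_growUp {y : ℝ} (hr : 0 < r) (hxB : xs < B) (hy : B ≤ y) {t : ℝ}
    (ht : 0 ≤ t) :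
    HasDerivAt (fun s => growUp r xs s y) (drift r cT xs B (growUp r xs t y)) t := by
  have hge : B ≤ growUp r xs t y := by
    have : 1 ≤ Real.exp (r * t) := Real.one_le_exp (by positivity)
    unfold growUp
    nlinarith
  rw [drift_of_ge hxB hge]
  have h := ((((hasDerivAt_id t).const_mul r).exp).const_mul (y - xs)).add_const xs
  refine h.congr_deriv ?_
  simp only [growUp, id]
  ring

theorem hasDerivAt_growMid_aux (hrc : r ≠ cT) (y t : ℝ) :
    HasDerivAt (fun s => growMid r cT xs B s y)
      (r * (growMid r cT xs B t y - xs) + cT * (B - growMid r cT xs B t y)) t := by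
  have h := ((((hasDerivAt_id t).const_mul (r - cT)).exp).const_mul
    (y + xss r cT xs B)).sub_const (xss r cT xs B)
  refine h.congr_deriv ?_
  rw [← mul_add_xss hrc]
  simp only [growMid, id]
  ring

theorem growMid_mono (hr : 0 < r) (hc : 0 < cT) (hrc : r ≠ cT) (_hxB : xs < B) {y : ℝ}
    (h1 : xs ≤ y) (h2 : y ≤ B) : Monotone (fun s => growMid r cT xs B s y) := by
  refine monotone_of_deriv_nonneg (fun t => (hasDerivAt_growMid_aux hrc y t).differentiableAt) ?_
  intro t
  rw [(hasDerivAt_growMid_aux hrc y t).deriv, ← mul_add_xss hrc]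
  have : (r - cT) * (growMid r cT xs B t y + xss r cT xs B)
      = ((r - cT) * (y + xss r cT xs B)) * Real.exp ((r - cT) * t) := by
    unfold growMid; ring
  rw [this, mul_add_xss hrc]
  have : 0 ≤ r * (y - xs) := mul_nonneg hr.le (by linarith)
  have : 0 ≤ cT * (B - y) := mul_nonneg hc.le (by linarith)
  positivity

theorem growMid_zero (y : ℝ) : growMid r cT xs B 0 y = y := by
  simp [growMid]

theorem growUp_zero (y : ℝ) : growUp r xs 0 y = y := by
  simp [growUp]

theorem growLow_zero (y : ℝ) : growLow cT B 0 y = y := by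
  simp [growLow]

theorem ratio_mid (hr : 0 < r) (hc : 0 < cT) (hrc : r ≠ cT) (hxB : xs < B) {y : ℝ}
    (h1 : xs ≤ y) (h2 : y ≤ B) :
    (r - cT) * (y + xss r cT xs B) ≠ 0 ∧
    0 < (B + xss r cT xs B) / (y + xss r cT xs B) := by
  have hne : r - cT ≠ 0 := sub_ne_zero.2 hrc
  have hy : 0 < (r - cT) * (y + xss r cT xs B) := by
    rw [mul_add_xss hrc]
    rcases eq_or_lt_of_le h1 with h | h
    · have := mul_pos hc (show 0 < B - y by linarith)
      have := mul_nonneg hr.le (show 0 ≤ y - xs by linarith)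
      linarith
    · have := mul_nonneg hc.le (show 0 ≤ B - y by linarith)
      have := mul_pos hr (show 0 < y - xs by linarith)
      linarith
  have hB : 0 < (r - cT) * (B + xss r cT xs B) := by
    rw [mul_add_xss hrc]
    have := mul_pos hr (show 0 < B - xs by linarith)
    linarith
  refine ⟨hy.ne', ?_⟩
  rw [← mul_div_mul_left _ _ hne]
  positivity

theorem growMid_timeToB (hr : 0 < r) (hc : 0 < cT) (hrc : r ≠ cT) (hxB : xs < B) {y : ℝ}
    (h1 : xs ≤ y) (h2 : y ≤ B) : growMid r cT xs B (timeToB r cT xs B y) y = B := by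
  have hne : r - cT ≠ 0 := sub_ne_zero.2 hrc
  obtain ⟨hy, hq⟩ := ratio_mid hr hc hrc hxB h1 h2
  have hy' := right_ne_zero_of_mul hy
  unfold growMid timeToB
  rw [← mul_assoc, mul_one_div_cancel hne, one_mul, Real.exp_log hq]
  field_simp
  ring

theorem timeToB_nonneg (hr : 0 < r) (hc : 0 < cT) (hrc : r ≠ cT) (hxB : xs < B) {y : ℝ}
    (h1 : xs ≤ y) (h2 : y < B) : 0 ≤ timeToB r cT xs B y := by
  by_contra! hneg
  have := growMid_mono hr hc hrc hxB h1 h2.le hneg.le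
  simp only [growMid_zero, growMid_timeToB hr hc hrc hxB h1 h2.le] at this
  linarith

theorem hasDerivAt_flowMid (hr : 0 < r) (hc : 0 < cT) (hrc : r ≠ cT) (hxB : xs < B) {y : ℝ}
    (h1 : xs ≤ y) (h2 : y < B) {t : ℝ} (ht : 0 ≤ t) :
    HasDerivAt (fun s => flowMid r cT xs B s y) (drift r cT xs B (flowMid r cT xs B t y)) t := by
  refine glue_ode (drift r cT xs B) (fun s => growMid r cT xs B s y)
    (fun s => growUp r xs s B) _ (timeToB_nonneg hr hc hrc hxB h1 h2) ?_ ?_ ?_ t ht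
  · intro s hs hsa
    have ha := growMid_mono hr hc hrc hxB h1 h2.le hs
    have hb := growMid_mono hr hc hrc hxB h1 h2.le hsa
    simp only [growMid_zero, growMid_timeToB hr hc hrc hxB h1 h2.le] at ha hb
    rw [drift_of_mid (by linarith) hb]
    exact hasDerivAt_growMid_aux hrc y s
  · intro s hs
    exact hasDerivAt_growUp hr hxB le_rfl hs
  · simp only [growUp_zero, growMid_timeToB hr hc hrc hxB h1 h2.le]

theorem hasDerivAt_growLow_aux (y t : ℝ) :
    HasDerivAt (fun s => growLow cT B s y) (cT * (B - growLow cT B t y)) t := by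
  have h := ((((hasDerivAt_id t).const_mul (-cT)).exp).const_mul (y - B)).add_const B
  refine h.congr_deriv ?_
  simp only [growLow, id]
  ring

theorem growLow_mono (hc : 0 < cT) {y : ℝ} (h : y ≤ B) :
    Monotone (fun s => growLow cT B s y) := by
  intro s t hst
  have : Real.exp (-cT * t) ≤ Real.exp (-cT * s) := Real.exp_le_exp.2 (by nlinarith)
  simp only [growLow]
  nlinarith

theorem growLow_timeToXs (hc : 0 < cT) (hxB : xs < B) {y : ℝ} (h : y < xs) :
    growLow cT B (timeToXs cT xs B y) y = xs := by
  have hq : 0 < (xs - B) / (y - B) := div_pos_of_neg_of_neg (by linarith) (by linarith)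
  have hy : y - B ≠ 0 := by linarith
  have : -cT * (-(1 / cT) * Real.log ((xs - B) / (y - B))) = Real.log ((xs - B) / (y - B)) := by
    field_simp
  unfold growLow timeToXs
  rw [this, Real.exp_log hq]
  field_simp
  ring

theorem timeToXs_nonneg (hc : 0 < cT) (hxB : xs < B) {y : ℝ} (h : y < xs) :
    0 ≤ timeToXs cT xs B y := by
  by_contra! hneg
  have := growLow_mono hc (show y ≤ B by linarith) hneg.le
  simp only [growLow_zero, growLow_timeToXs hc hxB h] at this
  linarith

theorem flowMid_zero (hr : 0 < r) (hc : 0 < cT) (hrc : r ≠ cT) (hxB : xs < B) {y : ℝ}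
    (h1 : xs ≤ y) (h2 : y < B) : flowMid r cT xs B 0 y = y := by
  unfold flowMid
  rw [if_pos (timeToB_nonneg hr hc hrc hxB h1 h2), growMid_zero]

theorem flow_zero (hr : 0 < r) (hc : 0 < cT) (hrc : r ≠ cT) (hxB : xs < B) (y : ℝ) :
    flow r cT xs B 0 y = y := by
  unfold flow
  split_ifs with h1 h2
  · exact growUp_zero y
  · exact flowMid_zero hr hc hrc hxB h2 (not_le.1 h1)
  · unfold flowLow
    rw [if_pos (timeToXs_nonneg hc hxB (not_le.1 h2)), growLow_zero]

theorem hasDerivAt_flow (hr : 0 < r) (hc : 0 < cT) (hrc : r ≠ cT) (hxB : xs < B) (y : ℝ)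
    {t : ℝ} (ht : 0 ≤ t) :
    HasDerivAt (fun s => flow r cT xs B s y) (drift r cT xs B (flow r cT xs B t y)) t := by
  by_cases h1 : B ≤ y
  · simp only [flow, if_pos h1]
    exact hasDerivAt_growUp hr hxB h1 ht
  by_cases h2 : xs ≤ y
  · simp only [flow, if_neg h1, if_pos h2]
    exact hasDerivAt_flowMid hr hc hrc hxB h2 (not_le.1 h1) ht
  · simp only [flow, if_neg h1, if_neg h2]
    have h2' := not_le.1 h2
    refine glue_ode (drift r cT xs B) (fun s => growLow cT B s y)
      (fun s => flowMid r cT xs B s xs) _ (timeToXs_nonneg hc hxB h2') ?_ ?_ ?_ t ht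
    · intro s hs hsa
      have hb := growLow_mono hc (show y ≤ B by linarith) hsa
      simp only [growLow_timeToXs hc hxB h2'] at hb
      rw [drift_of_le hxB hb]
      exact hasDerivAt_growLow_aux y s
    · intro s hs
      exact hasDerivAt_flowMid hr hc hrc hxB le_rfl hxB hs
    · simp only [growLow_timeToXs hc hxB h2', flowMid_zero hr hc hrc hxB le_rfl hxB]

end Flow

/-! ### The capital process, path by path

`W n` is the waiting time before the `(n+1)`-st capital loss and `Z n` the proportion of capital
that remains after it. -/

/-- Time of the `n`-th capital loss (`lossTime W 0 = 0`). -/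
def lossTime (W : ℕ → ℝ) (n : ℕ) : ℝ := ∑ i ∈ Finset.range n, W i

/-- Number of capital losses in `[0, t]`; a Poisson process of intensity `lam` when the waiting
times are i.i.d. exponential with parameter `lam`. -/
def lossCount (W : ℕ → ℝ) (t : ℝ) : ℕ := Set.ncard {n : ℕ | lossTime W (n + 1) ≤ t}

/-- Capital immediately after the `n`-th loss, for initial capital `x`. -/
def postLoss (r cT xs B : ℝ) (W Z : ℕ → ℝ) (x : ℝ) : ℕ → ℝ
  | 0 => x
  | n + 1 => Z n * flow r cT xs B (W n) (postLoss r cT xs B W Z x n)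

/-- The capital `X_t`, for initial capital `x`. -/
def capital (r cT xs B : ℝ) (W Z : ℕ → ℝ) (x t : ℝ) : ℝ :=
  flow r cT xs B (t - lossTime W (lossCount W t))
    (postLoss r cT xs B W Z x (lossCount W t))

/-- Cumulative extreme poverty rate `∫₀ᵗ ω(X_s) 1_{X_s < x*} ds` of a path `X`. -/
def cumRate (xs : ℝ) (omega : ℝ → ℝ) (X : ℝ → ℝ) (t : ℝ) : ℝ≥0∞ :=
  ∫⁻ s in Set.Ioc 0 t, ENNReal.ofReal (if X s < xs then omega (X s) else 0)

/-- Time of extreme poverty of a path `X`: the first time at which the cumulative rate reaches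
the level `e`, and `∞` if there is none. With a unit exponential level `e`, independent of the
path, extreme poverty occurs with conditional intensity `ω(X_s) 1_{X_s < x*}` at time `s`. -/
def povertyTime (xs : ℝ) (omega : ℝ → ℝ) (X : ℝ → ℝ) (e : ℝ) : ℝ≥0∞ :=
  ⨅ (t : ℝ≥0) (_ : ENNReal.ofReal e ≤ cumRate xs omega X t), (t : ℝ≥0∞)

open Classical in
/-- Discounted penalty `w(X_{τ-}, |X_τ - x*|) e^{-δτ} 1_{τ < ∞}` at the time `τ` of extreme
poverty of a path `X`. -/
def discountedPenalty (xs delta : ℝ) (omega : ℝ → ℝ) (w : ℝ → ℝ → ℝ) (X : ℝ → ℝ) (e : ℝ) : ℝ :=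
  if povertyTime xs omega X e < ∞ then
    w (Function.leftLim X (povertyTime xs omega X e).toReal)
        |X (povertyTime xs omega X e).toReal - xs|
      * Real.exp (-delta * (povertyTime xs omega X e).toReal)
  else 0

/-! ### The random inputs -/

/-- The random inputs of the model on a probability space `(Ω, P)`: waiting times `W n`,
exponential with parameter `lam`, between capital losses; remaining proportions `Z n` with law
`G`; a unit exponential level `E` that triggers extreme poverty; all of them independent. -/
structure IsModelInput {Ω : Type*} [MeasurableSpace Ω] (P : Measure Ω) (lam : ℝ) (G : Measure ℝ)
    (W Z : ℕ → Ω → ℝ) (E : Ω → ℝ) : Prop where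
  law_W : ∀ n, HasLaw (W n) (expMeasure lam) P
  law_Z : ∀ n, HasLaw (Z n) G P
  law_E : HasLaw E (expMeasure 1) P
  indep : iIndepFun (Sum.elim W (Sum.elim Z fun _ : Unit => E)) P

/-- The discounted penalty as a random variable, for initial capital `x`. -/
def penaltyVar {Ω : Type*} (r cT xs B delta : ℝ) (omega : ℝ → ℝ) (w : ℝ → ℝ → ℝ)
    (W Z : ℕ → Ω → ℝ) (E : Ω → ℝ) (x : ℝ) (o : Ω) : ℝ :=
  discountedPenalty xs delta omega w
    (capital r cT xs B (fun n => W n o) (fun n => Z n o) x) (E o)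

end Household

end

/-! Between losses the capital moves along a deterministic increasing semigroup `φ` with velocity `b
= drift`, and it is killed at rate `k`, which is `omega` below `xs` and `0` above. Let `K(y, t)` be
the rate accumulated along `φ` from `y`, and let `q(u) = k(u) v(u) + lam * ∫ V(z u) dG(z)`, where
`v(u) = w(u, xs - u)` is the penalty and `V` the expected penalty. Decomposing at a fixed time `t`
gives `V(y) = ∫₀ᵗ exp(-(lam + delta) s - K(y, s)) q(φ_s y) ds + exp(-(lam + delta) t - K(y, t))
V(φ_t y)`, which is `value_flow`. Differentiation along the flow yields `b V' = (lam + delta + k) V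
- q`. The three equations of the theorem are this single equation, with `b` written out on each
region.

No Markov property in continuous time is needed. The penalty of a path is a series over the number
of losses before killing (`discountedPenalty_path`). Integrating out the exponential level `E` by
the change of variables `e = K(y, s)` (`lintegral_Ioc_cumKill`), and then the waiting times and
proportions one at a time, turns the expectation into a Neumann series `∑ Qⁿ f`
(`lintegral_penaltySum`). Splitting off its first term is the renewal equation `value_eq`. Sums and
integrals are taken in `ℝ≥0∞`, so exchanging them costs nothing.

For regularity, the flow from one level `y` passes through every `x ≥ y`, at time `θ x - θ y`, so
`V` near `x` is a smooth expression in primitives of `q` and `k` along that one trajectory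
(`eq_valueAlong`). Hence `V` is continuous, then `q` is continuous wherever `k` and `v` are, and
there `V` is differentiable. From `xs` upwards there is no killing, and the trajectory started at
`xs` itself gives the one-sided derivative. The almost everywhere statement is Lebesgue
differentiation in time, carried to levels by the differentiable flow.

The limit at infinity is pathwise, followed by dominated convergence. From a high start there is no
killing during the first `N` losses, so discounting makes the penalty small. Under the net profit
condition the random walk with steps `r W_i + log Z_i` drifts to infinity, and a path that starts
high enough is never killed. -/

namespace KilledFlow

/-! ### Accumulated killing along an increasing flow, and its crossing times. -/

/-- A measurable semigroup of growing continuous trajectories on `(0, ∞)`. -/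
structure IsGrowthFlow (φ : ℝ → ℝ → ℝ) : Prop where
  measurable : Measurable fun p : ℝ × ℝ => φ p.1 p.2
  zero : ∀ y, 0 < y → φ 0 y = y
  add : ∀ s t y, 0 ≤ s → 0 ≤ t → 0 < y → φ (s + t) y = φ t (φ s y)
  mono : ∀ y, 0 < y → MonotoneOn (fun t => φ t y) (Set.Ici 0)
  cont : ∀ y, 0 < y → ContinuousOn (fun t => φ t y) (Set.Ici 0)

/-- A measurable killing rate that decreases with the level. -/
structure IsKillingRate (k : ℝ → ℝ) : Prop where
  measurable : Measurable k
  nonneg : ∀ y, 0 ≤ k y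
  anti : AntitoneOn k (Set.Ioi 0)

/-- The killing rate at time `s` along the flow from `y` (frozen for negative times). -/
noncomputable def rateAlong (φ : ℝ → ℝ → ℝ) (k : ℝ → ℝ) (y s : ℝ) : ℝ := k (φ (max s 0) y)

/-- The killing rate accumulated along the flow from `y` up to time `t`. -/
noncomputable def cumKill (φ : ℝ → ℝ → ℝ) (k : ℝ → ℝ) (y t : ℝ) : ℝ :=
  ∫ s in (0 : ℝ)..t, rateAlong φ k y s

/-- The first time at which the killing rate accumulated along the flow from `y` reaches `e`. -/
noncomputable def crossing (φ : ℝ → ℝ → ℝ) (k : ℝ → ℝ) (y e : ℝ) : ℝ≥0∞ :=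
  ⨅ q : ℚ, if 0 ≤ (q : ℝ) ∧ e ≤ cumKill φ k y q then ENNReal.ofReal q else ∞

/-- The discounted payoff at the crossing time of the level `e` along the flow from `y`. -/
noncomputable def killPay (φ : ℝ → ℝ → ℝ) (k v : ℝ → ℝ) (δ y e : ℝ) : ℝ≥0∞ :=
  ENNReal.ofReal (Real.exp (-δ * (crossing φ k y e).toReal) * v (φ (crossing φ k y e).toReal y))

section Flow

variable {φ : ℝ → ℝ → ℝ} {k v : ℝ → ℝ} {δ : ℝ}

theorem IsGrowthFlow.le (h : IsGrowthFlow φ) {y t : ℝ} (hy : 0 < y) (ht : 0 ≤ t) : y ≤ φ t y := by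
  have := h.mono y hy (Set.mem_Ici.2 le_rfl) (Set.mem_Ici.2 ht) ht
  simpa [h.zero y hy] using this

theorem IsGrowthFlow.pos (h : IsGrowthFlow φ) {y t : ℝ} (hy : 0 < y) (ht : 0 ≤ t) : 0 < φ t y :=
  hy.trans_le (h.le hy ht)

theorem rateAlong_of_nonneg {y s : ℝ} (hs : 0 ≤ s) : rateAlong φ k y s = k (φ s y) := by
  rw [rateAlong, max_eq_left hs]

theorem rateAlong_nonneg (hk : IsKillingRate k) (y s : ℝ) : 0 ≤ rateAlong φ k y s := hk.nonneg _

/-- The flow rises and the rate falls with the level. Monotonicity is the only regularity of the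
rate: it gives integrability and at most countably many discontinuities. Freezing negative times
makes it hold on the whole line. -/
theorem rateAlong_antitone (h : IsGrowthFlow φ) (hk : IsKillingRate k) {y : ℝ} (hy : 0 < y) :
    Antitone (rateAlong φ k y) := by
  intro s t hst
  have h1 : (0 : ℝ) ≤ max s 0 := le_max_right _ _
  have h2 : (0 : ℝ) ≤ max t 0 := le_max_right _ _
  exact hk.anti (h.pos hy h1) (h.pos hy h2) (h.mono y hy h1 h2 (max_le_max_right 0 hst))

theorem measurable_rateAlong (h : IsGrowthFlow φ) (hk : IsKillingRate k) :
    Measurable fun p : ℝ × ℝ => rateAlong φ k p.1 p.2 :=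
  hk.measurable.comp
    (h.measurable.comp ((measurable_snd.max measurable_const).prodMk measurable_fst))

theorem intervalIntegrable_rateAlong (h : IsGrowthFlow φ) (hk : IsKillingRate k) {y : ℝ}
    (hy : 0 < y) (a b : ℝ) : IntervalIntegrable (rateAlong φ k y) volume a b :=
  (rateAlong_antitone h hk hy).intervalIntegrable

theorem cumKill_zero (y : ℝ) : cumKill φ k y 0 = 0 := by simp [cumKill]

theorem cumKill_sub (h : IsGrowthFlow φ) (hk : IsKillingRate k) {y : ℝ} (hy : 0 < y) (s t : ℝ) :
    cumKill φ k y t - cumKill φ k y s = ∫ u in s..t, rateAlong φ k y u :=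
  intervalIntegral.integral_interval_sub_left (intervalIntegrable_rateAlong h hk hy _ _)
    (intervalIntegrable_rateAlong h hk hy _ _)

theorem cumKill_mono (h : IsGrowthFlow φ) (hk : IsKillingRate k) {y : ℝ} (hy : 0 < y) :
    Monotone (cumKill φ k y) := by
  intro s t hst
  rw [← sub_nonneg, cumKill_sub h hk hy]
  exact intervalIntegral.integral_nonneg hst fun _ _ => rateAlong_nonneg hk _ _

theorem cumKill_nonneg (hk : IsKillingRate k) (y : ℝ) {t : ℝ} (ht : 0 ≤ t) :
    0 ≤ cumKill φ k y t :=
  intervalIntegral.integral_nonneg ht fun _ _ => rateAlong_nonneg hk _ _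

theorem continuous_cumKill (h : IsGrowthFlow φ) (hk : IsKillingRate k) {y : ℝ} (hy : 0 < y) :
    Continuous (cumKill φ k y) :=
  intervalIntegral.continuous_primitive (intervalIntegrable_rateAlong h hk hy) 0

/-- An antitone integrand is bounded below by its terminal value. Thus a positive rate at `t` makes
the accumulated rate strictly smaller at all earlier times. -/
theorem mul_rateAlong_le_cumKill_sub (h : IsGrowthFlow φ) (hk : IsKillingRate k) {y : ℝ}
    (hy : 0 < y) {s t : ℝ} (hst : s ≤ t) :
    (t - s) * rateAlong φ k y t ≤ cumKill φ k y t - cumKill φ k y s := by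
  rw [cumKill_sub h hk hy]
  have := intervalIntegral.integral_mono_on hst (f := fun _ => rateAlong φ k y t)
    (g := rateAlong φ k y) (by simp)
    (intervalIntegrable_rateAlong h hk hy _ _) fun u hu => rateAlong_antitone h hk hy hu.2
  simpa using this

theorem hasDerivAt_cumKill (h : IsGrowthFlow φ) (hk : IsKillingRate k) {y t : ℝ} (hy : 0 < y)
    (hc : ContinuousAt (rateAlong φ k y) t) :
    HasDerivAt (cumKill φ k y) (rateAlong φ k y t) t :=
  intervalIntegral.integral_hasDerivAt_right (intervalIntegrable_rateAlong h hk hy _ _)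
    ((measurable_rateAlong h hk).comp
      measurable_prodMk_left).stronglyMeasurable.stronglyMeasurableAtFilter hc

theorem cumKill_add (h : IsGrowthFlow φ) (hk : IsKillingRate k) {y s t : ℝ} (hy : 0 < y)
    (hs : 0 ≤ s) (ht : 0 ≤ t) :
    cumKill φ k y (s + t) = cumKill φ k y s + cumKill φ k (φ s y) t := by
  rw [← sub_eq_iff_eq_add', cumKill_sub h hk hy, cumKill]
  have h1 := intervalIntegral.integral_comp_add_right (a := 0) (b := t) (rateAlong φ k y) s
  rw [zero_add, add_comm t s] at h1
  rw [← h1]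
  refine intervalIntegral.integral_congr fun u hu => ?_
  rw [Set.uIcc_of_le ht] at hu
  rw [rateAlong_of_nonneg hu.1, rateAlong_of_nonneg (by linarith [hu.1]), add_comm,
    h.add s u y hs hu.1 hy]

theorem measurable_cumKill (h : IsGrowthFlow φ) (hk : IsKillingRate k) :
    Measurable fun p : ℝ × ℝ => cumKill φ k p.1 p.2 := by
  -- An interval integral is a difference of two integrals over half-open intervals; writing these
  -- with indicators moves the variable endpoints into a jointly measurable integrand.
  have key : ∀ a b : ℝ × ℝ → ℝ, Measurable a → Measurable b →
      Measurable fun p : ℝ × ℝ => ∫ s in Set.Ioc (a p) (b p), rateAlong φ k p.1 s := by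
    intro a b ha hb
    have h1 : Measurable fun q : (ℝ × ℝ) × ℝ =>
        if a q.1 < q.2 ∧ q.2 ≤ b q.1 then rateAlong φ k q.1.1 q.2 else 0 := by
      refine Measurable.ite ?_ ((measurable_rateAlong h hk).comp
        ((measurable_fst.comp measurable_fst).prodMk measurable_snd)) measurable_const
      exact (measurableSet_lt (ha.comp measurable_fst) measurable_snd).inter
        (measurableSet_le measurable_snd (hb.comp measurable_fst))
    have h2 := (StronglyMeasurable.integral_prod_right' (ν := (volume : Measure ℝ))
      h1.stronglyMeasurable).measurable
    convert h2 using 2 with p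
    rw [← integral_indicator measurableSet_Ioc]
    simp only [Set.indicator_apply, Set.mem_Ioc]
  exact (key _ _ measurable_const measurable_snd).sub (key _ _ measurable_snd measurable_const)

/-- The infimum in `crossing` runs over rational times precisely so that it is countable; by
density, `crossing_eq` recovers the first time among all reals. -/
theorem measurable_crossing (h : IsGrowthFlow φ) (hk : IsKillingRate k) :
    Measurable fun p : ℝ × ℝ => crossing φ k p.1 p.2 := by
  refine Measurable.iInf fun q => Measurable.ite ?_ measurable_const measurable_const
  exact (MeasurableSet.const _).inter (measurableSet_le measurable_snd
    ((measurable_cumKill h hk).comp (measurable_fst.prodMk measurable_const)))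

theorem measurable_killPay (h : IsGrowthFlow φ) (hk : IsKillingRate k) (hv : Measurable v) :
    Measurable fun p : ℝ × ℝ => killPay φ k v δ p.1 p.2 := by
  have h1 : Measurable fun p : ℝ × ℝ => (crossing φ k p.1 p.2).toReal :=
    (measurable_crossing h hk).ennreal_toReal
  exact ((Real.measurable_exp.comp (h1.const_mul _)).mul
    (hv.comp (h.measurable.comp (h1.prodMk measurable_fst)))).ennreal_ofReal

theorem crossing_eq {y e s : ℝ} (hs : 0 ≤ s) (h1 : ∀ u, 0 ≤ u → u < s → cumKill φ k y u < e)
    (h2 : ∀ u, s ≤ u → e ≤ cumKill φ k y u) : crossing φ k y e = ENNReal.ofReal s := by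
  refine le_antisymm ?_ (le_iInf fun q => ?_)
  · refine le_of_forall_gt fun a ha => ?_
    obtain ⟨b, hb1, hb2⟩ := ENNReal.lt_iff_exists_real_btwn.1 ha
    obtain ⟨hb, hb2⟩ := hb2
    have hsb : s < b := (ENNReal.ofReal_lt_ofReal_iff_of_nonneg hs).1 hb
    obtain ⟨q, hq1, hq2⟩ := exists_rat_btwn hsb
    refine lt_of_le_of_lt (iInf_le _ q) ?_
    rw [if_pos ⟨by linarith, h2 _ hq1.le⟩]
    exact (ENNReal.ofReal_le_ofReal hq2.le).trans_lt hb2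
  · split_ifs with hq
    · refine ENNReal.ofReal_le_ofReal ?_
      by_contra! hlt
      exact absurd hq.2 (not_le.2 (h1 _ hq.1 hlt))
    · exact le_top

theorem crossing_cumKill (h : IsGrowthFlow φ) (hk : IsKillingRate k) {y s : ℝ} (hy : 0 < y)
    (hs : 0 ≤ s) (hpos : 0 < rateAlong φ k y s) :
    crossing φ k y (cumKill φ k y s) = ENNReal.ofReal s := by
  refine crossing_eq hs (fun u _ hus => ?_) fun u hu => cumKill_mono h hk hy hu
  have := mul_rateAlong_le_cumKill_sub h hk hy hus.le
  have := mul_pos (sub_pos.2 hus) hpos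
  linarith

theorem exists_crossing (h : IsGrowthFlow φ) (hk : IsKillingRate k) {y e t : ℝ} (hy : 0 < y)
    (he : 0 < e) (ht : 0 ≤ t) (het : e < cumKill φ k y t) :
    ∃ s, 0 < s ∧ s < t ∧ crossing φ k y e = ENNReal.ofReal s ∧
      (∀ u, u < s → cumKill φ k y u < e) ∧ cumKill φ k y s = e := by
  have hcont := continuous_cumKill h hk hy
  have hmono := cumKill_mono h hk hy
  obtain ⟨a, ⟨ha0, hat⟩, hae⟩ := intermediate_value_Icc ht hcont.continuousOn
    (show e ∈ Set.Icc _ _ from ⟨by rw [cumKill_zero]; exact he.le, het.le⟩)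
  -- The first time at which `e` is reached: a nonempty compact set of times has a least element.
  obtain ⟨s, ⟨hs1, hs2⟩, hsl⟩ := ((isCompact_Icc (a := (0 : ℝ)) (b := t)).inter_right
    (isClosed_Ici.preimage hcont (t := Set.Ici e))).exists_isLeast ⟨a, ⟨ha0, hat⟩, hae.ge⟩
  have hs2 : e ≤ cumKill φ k y s := hs2
  have hlt : ∀ u, u < s → cumKill φ k y u < e := by
    intro u hus
    by_contra! hu
    have hu0 : 0 ≤ u := by
      by_contra! hneg
      have := hmono hneg.le
      rw [cumKill_zero] at this
      linarith
    exact absurd (hsl ⟨⟨hu0, by linarith [hs1.2]⟩, hu⟩) (not_le.2 hus)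
  have hsa : s ≤ a := hsl ⟨⟨ha0, hat⟩, hae.ge⟩
  have hse : cumKill φ k y s = e := le_antisymm (hae ▸ hmono hsa) hs2
  refine ⟨s, ?_, ?_, crossing_eq hs1.1 (fun u _ => hlt u) fun u hu => hs2.trans (hmono hu), hlt,
    hse⟩
  · rcases eq_or_lt_of_le hs1.1 with h0 | h0
    · rw [← h0, cumKill_zero] at hse; linarith
    · exact h0
  · rcases eq_or_lt_of_le hs1.2 with h0 | h0
    · rw [h0] at hse; linarith
    · exact h0

/-- Integrating a functional of the crossing time against the accumulated rate. -/
theorem lintegral_Ioc_cumKill (h : IsGrowthFlow φ) (hk : IsKillingRate k) {y t : ℝ} (hy : 0 < y)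
    (ht : 0 ≤ t) :
    ∫⁻ u in Set.Ioc 0 (cumKill φ k y t), ENNReal.ofReal (Real.exp (-u)) * killPay φ k v δ y u
      = ∫⁻ s in Set.Ioc 0 t, ENNReal.ofReal (rateAlong φ k y s) *
          (ENNReal.ofReal (Real.exp (-cumKill φ k y s)) *
            ENNReal.ofReal (Real.exp (-δ * s) * v (φ s y))) := by
  set g := rateAlong φ k y with hg
  set f := cumKill φ k y with hf
  -- Off this countable set the accumulated rate has derivative `g`, so `u = f s` is an admissible
  -- monotone change of variables on `S`. Injectivity is not required.
  set D : Set ℝ := {s | ¬ContinuousAt g s} with hD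
  have hDc : D.Countable := (rateAlong_antitone h hk hy).countable_not_continuousAt
  set S : Set ℝ := Set.Ioc 0 t \ D with hS
  have hSm : MeasurableSet S := measurableSet_Ioc.diff hDc.measurableSet
  have hmono : Monotone f := cumKill_mono h hk hy
  have hcv := lintegral_image_eq_lintegral_deriv_mul_of_monotoneOn (f := f) (f' := g) hSm
    (fun s hs => (hasDerivAt_cumKill h hk hy (not_not.1 hs.2)).hasDerivWithinAt)
    (hmono.monotoneOn S)
    (fun u => ENNReal.ofReal (Real.exp (-u)) * killPay φ k v δ y u)
  have hsub : Set.Ioc 0 (f t) ⊆ f '' S ∪ f '' D := by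
    intro u hu
    have h0 : f 0 = 0 := cumKill_zero y
    obtain ⟨s, hs, rfl⟩ := intermediate_value_Icc ht (continuous_cumKill h hk hy).continuousOn
      (show u ∈ Set.Icc (f 0) (f t) from ⟨by rw [h0]; exact hu.1.le, hu.2⟩)
    have hs0 : 0 < s := by
      rcases eq_or_lt_of_le hs.1 with h1 | h1
      · rw [← h1] at hu; exact absurd hu.1 (by rw [← hf, h0]; exact lt_irrefl _)
      · exact h1
    by_cases hsD : s ∈ D
    · exact Or.inr ⟨s, hsD, rfl⟩
    · exact Or.inl ⟨s, ⟨⟨hs0, hs.2⟩, hsD⟩, rfl⟩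
  have hsub2 : f '' S ⊆ Set.Ioc 0 (f t) ∪ {0} := by
    rintro _ ⟨s, hs, rfl⟩
    rcases eq_or_lt_of_le (cumKill_nonneg (φ := φ) hk y hs.1.1.le) with h1 | h1
    · exact Or.inr h1.symm
    · exact Or.inl ⟨h1, hmono hs.1.2⟩
  -- The image of `S` fills the interval up to the countable set `f '' D` and the point `0`.
  have hae : (Set.Ioc 0 (f t) : Set ℝ) =ᵐ[volume] f '' S := by
    refine Filter.EventuallyLE.antisymm ?_ ?_
    · refine (hsub.eventuallyLE).trans ?_
      exact (union_ae_eq_left_of_ae_eq_empty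
        (ae_eq_empty.2 ((hDc.image f).measure_zero _))).le
    · refine (hsub2.eventuallyLE).trans ?_
      exact (union_ae_eq_left_of_ae_eq_empty (ae_eq_empty.2 (measure_singleton _))).le
  have hae2 : (Set.Ioc 0 t : Set ℝ) =ᵐ[volume] S :=
    (sdiff_null_ae_eq_self (hDc.measure_zero _)).symm
  rw [setLIntegral_congr hae, hcv, setLIntegral_congr hae2]
  refine setLIntegral_congr_fun hSm fun s hs => ?_
  -- Where the rate vanishes the integrand is zero, so the crossing time has to invert `f` only at
  -- points of positive rate.
  rcases eq_or_lt_of_le (rateAlong_nonneg (φ := φ) hk y s) with h1 | h1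
  · simp only [hg, ← h1, ENNReal.ofReal_zero, zero_mul]
  · simp only [killPay]
    rw [hf, crossing_cumKill h hk hy hs.1.1.le h1, ENNReal.toReal_ofReal hs.1.1.le]

end Flow

end KilledFlow

/-! ### Paths with losses: the penalty of a path as a series over loss intervals. -/

namespace KilledFlow

open Household (lossTime lossCount cumRate povertyTime discountedPenalty)

/-- Level just after the `n`-th proportional loss. -/
noncomputable def postLevel (φ : ℝ → ℝ → ℝ) (W Z : ℕ → ℝ) (x : ℝ) : ℕ → ℝ
  | 0 => x
  | n + 1 => Z n * φ (W n) (postLevel φ W Z x n)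

/-- Killing rate accumulated up to the `n`-th loss. -/
noncomputable def killAt (φ : ℝ → ℝ → ℝ) (k : ℝ → ℝ) (W Z : ℕ → ℝ) (x : ℝ) : ℕ → ℝ
  | 0 => 0
  | n + 1 => killAt φ k W Z x n + cumKill φ k (postLevel φ W Z x n) (W n)

/-- Level at time `t`. -/
noncomputable def path (φ : ℝ → ℝ → ℝ) (W Z : ℕ → ℝ) (x t : ℝ) : ℝ :=
  φ (t - lossTime W (lossCount W t)) (postLevel φ W Z x (lossCount W t))

/-- The discounted payoff at the killing time, split according to the number of losses that
precede it. -/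
noncomputable def penaltySum (φ : ℝ → ℝ → ℝ) (k v : ℝ → ℝ) (δ : ℝ) (W Z : ℕ → ℝ) (x e : ℝ) :
    ℝ≥0∞ :=
  ∑' n, if killAt φ k W Z x n < e ∧ e ≤ killAt φ k W Z x (n + 1) then
    ENNReal.ofReal (Real.exp (-δ * lossTime W n)) *
      killPay φ k v δ (postLevel φ W Z x n) (e - killAt φ k W Z x n) else 0

section Path

variable {φ : ℝ → ℝ → ℝ} {k v : ℝ → ℝ} {δ : ℝ} {W Z : ℕ → ℝ} {x e : ℝ}

theorem lossTime_succ (W : ℕ → ℝ) (n : ℕ) : lossTime W (n + 1) = lossTime W n + W n := by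
  simp [lossTime, Finset.sum_range_succ]

theorem lossTime_strictMono (hW : ∀ n, 0 < W n) : StrictMono (lossTime W) :=
  strictMono_nat_of_lt_succ fun n => by rw [lossTime_succ]; linarith [hW n]

theorem lossTime_nonneg (hW : ∀ n, 0 < W n) (n : ℕ) : 0 ≤ lossTime W n :=
  Finset.sum_nonneg fun i _ => (hW i).le

theorem lossCount_eq (hW : ∀ n, 0 < W n) {n : ℕ} {t : ℝ} (h1 : lossTime W n ≤ t)
    (h2 : t < lossTime W (n + 1)) : lossCount W t = n := by
  have : {m : ℕ | lossTime W (m + 1) ≤ t} = Set.Iio n := by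
    ext m
    simp only [Set.mem_ofPred_eq, Set.mem_Iio]
    constructor
    · intro hm
      have := (lossTime_strictMono hW).lt_iff_lt.1 (hm.trans_lt h2)
      omega
    · intro hm
      exact ((lossTime_strictMono hW).monotone (by omega)).trans h1
  rw [lossCount, this, ← Finset.coe_Iio, Set.ncard_coe_finset, Nat.card_Iio]

theorem exists_lossTime_le (hT : Tendsto (lossTime W) atTop atTop) {t : ℝ} (ht : 0 ≤ t) :
    ∃ n, lossTime W n ≤ t ∧ t < lossTime W (n + 1) := by
  classical
  have hex : ∃ n, t < lossTime W (n + 1) :=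
    (((tendsto_add_atTop_iff_nat 1).2 hT).eventually_gt_atTop t).exists
  refine ⟨Nat.find hex, ?_, Nat.find_spec hex⟩
  rcases Nat.eq_zero_or_pos (Nat.find hex) with h0 | h0
  · rw [h0]; simpa [lossTime] using ht
  · have := Nat.find_min hex (m := Nat.find hex - 1) (by omega)
    rw [Nat.sub_add_cancel h0] at this
    exact not_lt.1 this

theorem path_eq (hW : ∀ n, 0 < W n) {n : ℕ} {t : ℝ} (h1 : lossTime W n ≤ t)
    (h2 : t < lossTime W (n + 1)) :
    path φ W Z x t = φ (t - lossTime W n) (postLevel φ W Z x n) := by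
  rw [path, lossCount_eq hW h1 h2]

theorem postLevel_pos (h : IsGrowthFlow φ) (hW : ∀ n, 0 < W n) (hZ : ∀ n, 0 < Z n) (hx : 0 < x)
    (n : ℕ) : 0 < postLevel φ W Z x n := by
  induction n with
  | zero => exact hx
  | succ n ih => exact mul_pos (hZ n) (h.pos ih (hW n).le)

theorem killAt_succ (n : ℕ) : killAt φ k W Z x (n + 1)
    = killAt φ k W Z x n + cumKill φ k (postLevel φ W Z x n) (W n) := rfl

theorem killAt_mono (hk : IsKillingRate k) (hW : ∀ n, 0 < W n) : Monotone (killAt φ k W Z x) :=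
  monotone_nat_of_le_succ fun n => by
    rw [killAt_succ]; linarith [cumKill_nonneg (φ := φ) hk (postLevel φ W Z x n) (hW n).le]

theorem killAt_nonneg (hk : IsKillingRate k) (hW : ∀ n, 0 < W n) (n : ℕ) :
    0 ≤ killAt φ k W Z x n := killAt_mono hk hW (Nat.zero_le n)

/-- The half-open intervals between successive values of `killAt` are disjoint, so at most one term
of the series is nonzero. -/
theorem penaltySum_eq (hk : IsKillingRate k) (hW : ∀ n, 0 < W n) {n : ℕ}
    (h1 : killAt φ k W Z x n < e) (h2 : e ≤ killAt φ k W Z x (n + 1)) :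
    penaltySum φ k v δ W Z x e = ENNReal.ofReal (Real.exp (-δ * lossTime W n)) *
      killPay φ k v δ (postLevel φ W Z x n) (e - killAt φ k W Z x n) := by
  rw [penaltySum, tsum_eq_single n, if_pos ⟨h1, h2⟩]
  intro m hm
  rw [if_neg]
  rintro ⟨h3, h4⟩
  have hmono := killAt_mono (φ := φ) (Z := Z) (x := x) hk hW
  rcases lt_or_gt_of_ne hm with hlt | hlt
  · have := hmono (show m + 1 ≤ n by omega); linarith
  · have := hmono (show n + 1 ≤ m by omega); linarith

theorem penaltySum_eq_zero (hlt : ∀ n, killAt φ k W Z x n < e) :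
    penaltySum φ k v δ W Z x e = 0 := by
  rw [penaltySum, ENNReal.tsum_eq_zero]
  intro n
  rw [if_neg]
  rintro ⟨_, h2⟩
  exact absurd (hlt (n + 1)) (not_lt.2 h2)

/-- If killing has not occurred by the `N`-th loss, the payoff is discounted at least up to that
loss. `N = 0` gives the uniform bound `C`; large `N` gives decay under discounting. -/
theorem penaltySum_le (hk : IsKillingRate k) (hW : ∀ n, 0 < W n) (hδ : 0 ≤ δ) {C : ℝ}
    (hC : 0 ≤ C) (hv : ∀ y, v y ≤ C) {N : ℕ} (hN : killAt φ k W Z x N < e) :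
    penaltySum φ k v δ W Z x e ≤ ENNReal.ofReal (Real.exp (-δ * lossTime W N) * C) := by
  by_cases hex : ∃ n, killAt φ k W Z x n < e ∧ e ≤ killAt φ k W Z x (n + 1)
  · obtain ⟨n, h1, h2⟩ := hex
    have hNn : N ≤ n := by
      by_contra! hlt
      have := killAt_mono (φ := φ) (Z := Z) (x := x) hk hW (show n + 1 ≤ N by omega)
      linarith
    rw [penaltySum_eq hk hW h1 h2, ENNReal.ofReal_mul (Real.exp_pos _).le]
    refine mul_le_mul' (ENNReal.ofReal_le_ofReal (Real.exp_le_exp.2 ?_))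
      (ENNReal.ofReal_le_ofReal ?_)
    · have := (lossTime_strictMono hW).monotone hNn
      nlinarith
    · have h3 : Real.exp (-δ * (crossing φ k (postLevel φ W Z x n)
          (e - killAt φ k W Z x n)).toReal) ≤ 1 := by
        rw [Real.exp_le_one_iff]
        have := ENNReal.toReal_nonneg (a := crossing φ k (postLevel φ W Z x n)
          (e - killAt φ k W Z x n))
        nlinarith
      calc _ ≤ Real.exp (-δ * (crossing φ k (postLevel φ W Z x n)
          (e - killAt φ k W Z x n)).toReal) * C :=
            mul_le_mul_of_nonneg_left (hv _) (Real.exp_pos _).le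
        _ ≤ 1 * C := mul_le_mul_of_nonneg_right h3 hC
        _ = C := one_mul C
  · have : penaltySum φ k v δ W Z x e = 0 := by
      rw [penaltySum, ENNReal.tsum_eq_zero]
      intro n
      rw [if_neg]
      exact fun hn => hex ⟨n, hn⟩
    rw [this]
    exact zero_le

variable {xs : ℝ} {omega : ℝ → ℝ} {w : ℝ → ℝ → ℝ}

theorem lintegral_rate_path (h : IsGrowthFlow φ) (hk : IsKillingRate k)
    (hkw : ∀ y, 0 < y → (if y < xs then omega y else 0) = k y)
    (hW : ∀ n, 0 < W n) (hZ : ∀ n, 0 < Z n) (hx : 0 < x) {n : ℕ} {t : ℝ}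
    (h1 : lossTime W n ≤ t) (h2 : t ≤ lossTime W (n + 1)) :
    ∫⁻ s in Set.Ioc (lossTime W n) t, ENNReal.ofReal
        (if path φ W Z x s < xs then omega (path φ W Z x s) else 0)
      = ENNReal.ofReal (cumKill φ k (postLevel φ W Z x n) (t - lossTime W n)) := by
  have hpos := postLevel_pos h hW hZ hx n
  -- The right endpoint may be a loss time, where the path has already jumped; the formula `path_eq`
  -- holds on the interval closed on the left only.
  rw [setLIntegral_congr (Ico_ae_eq_Ioc (a := lossTime W n) (b := t)).symm]
  have hcongr : ∫⁻ s in Set.Ico (lossTime W n) t, ENNReal.ofReal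
        (if path φ W Z x s < xs then omega (path φ W Z x s) else 0)
      = ∫⁻ s in Set.Ico (lossTime W n) t, ENNReal.ofReal
        (rateAlong φ k (postLevel φ W Z x n) (s - lossTime W n)) := by
    refine setLIntegral_congr_fun measurableSet_Ico fun s hs => ?_
    have h0 : 0 ≤ s - lossTime W n := sub_nonneg.2 hs.1
    rw [path_eq hW hs.1 (hs.2.trans_le h2), hkw _ (h.pos hpos h0), rateAlong_of_nonneg h0]
  rw [hcongr, setLIntegral_congr Ico_ae_eq_Ioc, ← ofReal_integral_eq_lintegral_ofReal,
    ← intervalIntegral.integral_of_le h1,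
    intervalIntegral.integral_comp_sub_right (rateAlong φ k (postLevel φ W Z x n)), sub_self,
    cumKill]
  · have hi := (intervalIntegrable_rateAlong h hk hpos 0 (t - lossTime W n)).comp_sub_right
      (lossTime W n)
    simp only [zero_add, sub_add_cancel] at hi
    exact (intervalIntegrable_iff_integrableOn_Ioc_of_le h1).1 hi
  · exact ae_of_all _ fun s => rateAlong_nonneg hk _ _

theorem cumRate_add {X : ℝ → ℝ} {s t : ℝ} (hs : 0 ≤ s) (hst : s ≤ t) :
    cumRate xs omega X t = cumRate xs omega X s
      + ∫⁻ u in Set.Ioc s t, ENNReal.ofReal (if X u < xs then omega (X u) else 0) := by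
  rw [cumRate, cumRate, ← lintegral_union measurableSet_Ioc
    (Set.Ioc_disjoint_Ioc_of_le le_rfl), Set.Ioc_union_Ioc_eq_Ioc hs hst]

theorem cumRate_lossTime (h : IsGrowthFlow φ) (hk : IsKillingRate k)
    (hkw : ∀ y, 0 < y → (if y < xs then omega y else 0) = k y)
    (hW : ∀ n, 0 < W n) (hZ : ∀ n, 0 < Z n) (hx : 0 < x) (n : ℕ) :
    cumRate xs omega (path φ W Z x) (lossTime W n) = ENNReal.ofReal (killAt φ k W Z x n) := by
  induction n with
  | zero => simp [cumRate, lossTime, killAt]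
  | succ n ih =>
    have hlt := (lossTime_strictMono hW (Nat.lt_succ_self n)).le
    rw [cumRate_add (lossTime_nonneg hW n) hlt, ih,
      lintegral_rate_path h hk hkw hW hZ hx hlt le_rfl, killAt_succ,
      ENNReal.ofReal_add (killAt_nonneg hk hW n) (cumKill_nonneg hk _ (hW n).le)]
    congr 3
    rw [lossTime_succ]
    ring

theorem cumRate_path (h : IsGrowthFlow φ) (hk : IsKillingRate k)
    (hkw : ∀ y, 0 < y → (if y < xs then omega y else 0) = k y)
    (hW : ∀ n, 0 < W n) (hZ : ∀ n, 0 < Z n) (hx : 0 < x) {n : ℕ} {t : ℝ}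
    (h1 : lossTime W n ≤ t) (h2 : t ≤ lossTime W (n + 1)) :
    cumRate xs omega (path φ W Z x) t = ENNReal.ofReal
      (killAt φ k W Z x n + cumKill φ k (postLevel φ W Z x n) (t - lossTime W n)) := by
  rw [cumRate_add (lossTime_nonneg hW n) h1, cumRate_lossTime h hk hkw hW hZ hx,
    lintegral_rate_path h hk hkw hW hZ hx h1 h2,
    ENNReal.ofReal_add (killAt_nonneg hk hW n) (cumKill_nonneg hk _ (sub_nonneg.2 h1))]

theorem cumRate_mono {X : ℝ → ℝ} : Monotone (cumRate xs omega X) := fun _ _ hst =>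
  lintegral_mono_set (Set.Ioc_subset_Ioc_right hst)

theorem povertyTime_eq {X : ℝ → ℝ} {a : ℝ} (ha : 0 ≤ a)
    (h1 : ∀ t, 0 ≤ t → t < a → cumRate xs omega X t < ENNReal.ofReal e)
    (h2 : ENNReal.ofReal e ≤ cumRate xs omega X a) :
    povertyTime xs omega X e = ENNReal.ofReal a := by
  refine le_antisymm (iInf₂_le_of_le a.toNNReal (by rwa [Real.coe_toNNReal a ha]) le_rfl)
    (le_iInf₂ fun t ht => ?_)
  rw [← ENNReal.ofReal_coe_nnreal]
  refine ENNReal.ofReal_le_ofReal ?_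
  by_contra! hlt
  exact absurd ht (not_le.2 (h1 t t.2 hlt))

theorem povertyTime_eq_top {X : ℝ → ℝ} (h1 : ∀ t, 0 ≤ t → cumRate xs omega X t < ENNReal.ofReal e) :
    povertyTime xs omega X e = ∞ := by
  simp only [povertyTime, iInf_eq_top]
  intro t ht
  exact absurd ht (not_le.2 (h1 t t.2))

/-- Excluding ties (`hne`) puts the killing time strictly inside a loss interval. There the path is
continuous, so left limit and value coincide and the penalty depends on a single level. -/
theorem discountedPenalty_path (h : IsGrowthFlow φ) (hk : IsKillingRate k)
    (hkw : ∀ y, 0 < y → (if y < xs then omega y else 0) = k y)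
    (hv0 : ∀ y, 0 ≤ v y) (hv : ∀ y ∈ Set.Ioo 0 xs, v y = w y (xs - y))
    (hW : ∀ n, 0 < W n) (hZ : ∀ n, 0 < Z n) (hT : Tendsto (lossTime W) atTop atTop)
    (hx : 0 < x) (he : 0 < e) (hne : ∀ n, e ≠ killAt φ k W Z x n) :
    discountedPenalty xs δ omega w (path φ W Z x) e = (penaltySum φ k v δ W Z x e).toReal := by
  by_cases hall : ∀ n, killAt φ k W Z x n < e
  · rw [penaltySum_eq_zero hall, discountedPenalty, povertyTime_eq_top]
    · simp
    · intro t ht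
      obtain ⟨n, _, hn⟩ := exists_lossTime_le hT ht
      refine (cumRate_mono hn.le).trans_lt ?_
      rw [cumRate_lossTime h hk hkw hW hZ hx]
      exact (ENNReal.ofReal_lt_ofReal_iff he).2 (hall _)
  have hex : ∃ n, killAt φ k W Z x n < e ∧ e < killAt φ k W Z x (n + 1) := by
    classical
    simp only [not_forall, not_lt] at hall
    have h0 : Nat.find hall ≠ 0 := by
      intro h0
      have := Nat.find_spec hall
      rw [h0] at this
      exact absurd this (not_le.2 he)
    obtain ⟨n, hn⟩ := Nat.exists_eq_succ_of_ne_zero h0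
    refine ⟨n, not_le.1 (Nat.find_min hall (by omega)), lt_of_le_of_ne ?_ (hne _)⟩
    have := Nat.find_spec hall
    rwa [hn] at this
  obtain ⟨n, h1, h2⟩ := hex
  rw [penaltySum_eq hk hW h1 h2.le]
  set y := postLevel φ W Z x n with hy
  set c := killAt φ k W Z x n with hc
  set T := lossTime W n with hTn
  have hypos : 0 < y := postLevel_pos h hW hZ hx n
  rw [killAt_succ, ← hy, ← hc] at h2
  have hT0 : 0 ≤ T := lossTime_nonneg hW n
  have hT1 : lossTime W (n + 1) = T + W n := lossTime_succ W n
  obtain ⟨s, hs0, hsW, hcr, hlt, hse⟩ := exists_crossing h hk (e := e - c) hypos (by linarith)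
    (hW n).le (by linarith)
  have hpov : povertyTime xs omega (path φ W Z x) e = ENNReal.ofReal (T + s) := by
    refine povertyTime_eq (by linarith) (fun t ht hts => ?_) ?_
    -- Replacing `t` by `max t T` treats times before the current loss interval together with those
    -- inside it.
    · refine (cumRate_mono (le_max_left t T)).trans_lt ?_
      rw [cumRate_path (n := n) h hk hkw hW hZ hx (le_max_right _ _)
        (by rw [hT1]; exact max_le (by linarith) (by linarith)), ENNReal.ofReal_lt_ofReal_iff he]
      have := hlt (max t T - T) (by
        rcases max_cases t T with h3 | h3 <;> rw [h3.1] <;> linarith)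
      linarith
    · rw [cumRate_path (n := n) h hk hkw hW hZ hx (by linarith) (by rw [hT1]; linarith)]
      refine ENNReal.ofReal_le_ofReal ?_
      rw [← hTn, add_sub_cancel_left, ← hy, hse]
      linarith
  have hval : path φ W Z x (T + s) = φ s y := by
    rw [path_eq (n := n) hW (by linarith) (by rw [hT1]; linarith), ← hTn, add_sub_cancel_left]
  have hleft : Function.leftLim (path φ W Z x) (T + s) = φ s y := by
    refine leftLim_eq_of_tendsto ?_
    have h3 : Tendsto (fun t => φ (t - T) y) (𝓝[<] (T + s)) (𝓝 (φ s y)) := by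
      have h4 : ContinuousAt (fun t => φ t y) s :=
        (h.cont y hypos).continuousAt (Ici_mem_nhds hs0)
      have h5 : Tendsto (fun t => t - T) (𝓝[<] (T + s)) (𝓝 s) := by
        have : Tendsto (fun t => t - T) (𝓝 (T + s)) (𝓝 (T + s - T)) :=
          (continuous_id.sub continuous_const).tendsto _
        rw [add_sub_cancel_left] at this
        exact this.mono_left nhdsWithin_le_nhds
      exact h4.tendsto.comp h5
    refine h3.congr' ?_
    filter_upwards [Ioo_mem_nhdsLT (show T < T + s by linarith)] with t ht
    rw [path_eq (n := n) hW ht.1.le (by rw [hT1]; linarith [ht.2])]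
  -- If the level were already at least `xs`, the rate would vanish from `s` on, whereas the
  -- accumulated rate still grows strictly between `s` and `W n`.
  have hsub : φ s y < xs := by
    by_contra! hge
    have hzero : ∫ u in s..W n, rateAlong φ k y u = 0 := by
      refine intervalIntegral.integral_zero_ae (ae_of_all _ fun u hu => ?_)
      rw [Set.uIoc_of_le hsW.le] at hu
      have hu0 : 0 ≤ u := by linarith [hu.1]
      rw [rateAlong_of_nonneg hu0, ← hkw _ (h.pos hypos hu0), if_neg]
      exact not_lt.2 (hge.trans (h.mono y hypos (Set.mem_Ici.2 hs0.le) (Set.mem_Ici.2 hu0) hu.1.le))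
    rw [← cumKill_sub h hk hypos] at hzero
    linarith
  have hmem : φ s y ∈ Set.Ioo 0 xs := ⟨h.pos hypos hs0.le, hsub⟩
  rw [discountedPenalty, hpov, if_pos ENNReal.ofReal_lt_top,
    ENNReal.toReal_ofReal (by linarith), hleft, hval, abs_of_neg (by linarith), neg_sub,
    ← hv _ hmem, killPay, hcr, ENNReal.toReal_ofReal hs0.le, ← ENNReal.ofReal_mul (Real.exp_pos _).le,
    ENNReal.toReal_ofReal (mul_nonneg (Real.exp_pos _).le
      (mul_nonneg (Real.exp_pos _).le (hv0 _))), ← mul_assoc, ← Real.exp_add, mul_comm]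
  congr 2
  ring

end Path

end KilledFlow

/-! ### Taking expectations: the Neumann series of the loss chain. -/

namespace KilledFlow

open Household (lossTime)

/-! ### Integration against exponential laws -/

theorem lintegral_expMeasure (lam : ℝ) {f : ℝ → ℝ≥0∞} (hf : Measurable f) :
    ∫⁻ t, f t ∂(expMeasure lam)
      = ∫⁻ t in Set.Ioi 0, ENNReal.ofReal (lam * Real.exp (-(lam * t))) * f t := by
  have hm : Measurable (gammaPDF 1 lam) := (measurable_exponentialPDFReal lam).ennreal_ofReal
  rw [expMeasure, gammaMeasure, lintegral_withDensity_eq_lintegral_mul _ hm hf,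
    setLIntegral_congr Ioi_ae_eq_Ici, ← lintegral_indicator measurableSet_Ici]
  refine lintegral_congr fun t => ?_
  have h1 : gammaPDF 1 lam t = exponentialPDF lam t := rfl
  rw [Pi.mul_apply, h1]
  by_cases ht : 0 ≤ t
  · rw [exponentialPDF_of_nonneg ht, Set.indicator_of_mem (Set.mem_Ici.2 ht)]
  · rw [exponentialPDF_of_neg (not_le.1 ht), Set.indicator_of_notMem (by simpa using ht), zero_mul]

theorem expMeasure_Iic_zero (lam : ℝ) : expMeasure lam (Set.Iic 0) = 0 := by
  have h := lintegral_expMeasure lam (f := (Set.Iic (0 : ℝ)).indicator 1)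
    (measurable_const.indicator measurableSet_Iic)
  rw [lintegral_indicator_one measurableSet_Iic] at h
  rw [h, setLIntegral_congr_fun (g := fun _ => 0) measurableSet_Ioi]
  · simp
  · intro t ht
    simp [Set.mem_Ioi.1 ht]

theorem ae_expMeasure_pos (lam : ℝ) : ∀ᵐ t ∂(expMeasure lam), 0 < t := by
  rw [ae_iff]
  convert expMeasure_Iic_zero lam using 2
  ext t
  simp

theorem expMeasure_singleton (lam a : ℝ) : expMeasure lam {a} = 0 := by
  have h := lintegral_expMeasure lam (f := ({a} : Set ℝ).indicator 1)
    (measurable_const.indicator (measurableSet_singleton a))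
  rw [lintegral_indicator_one (measurableSet_singleton a)] at h
  rw [h]
  refine (lintegral_congr_ae ?_).trans lintegral_zero
  have : ∀ᵐ t : ℝ ∂volume.restrict (Set.Ioi 0), t ≠ a :=
    ae_restrict_of_ae (by simp [ae_iff])
  filter_upwards [this] with t ht
  simp [ht]

theorem lintegral_indepFun {Ω α β : Type*} [MeasurableSpace Ω] [MeasurableSpace α]
    [MeasurableSpace β] {P : Measure Ω} [IsFiniteMeasure P] {Y : Ω → α} {V : Ω → β}
    (hY : Measurable Y) (hV : Measurable V) (hind : IndepFun Y V P) {F : α × β → ℝ≥0∞}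
    (hF : Measurable F) :
    ∫⁻ o, F (Y o, V o) ∂P = ∫⁻ o, ∫⁻ b, F (Y o, b) ∂(P.map V) ∂P := by
  rw [← lintegral_map (f := F) hF (hY.prodMk hV),
    (indepFun_iff_map_prod_eq_prod_map_map hY.aemeasurable hV.aemeasurable).1 hind,
    lintegral_prod _ hF.aemeasurable,
    lintegral_map (f := fun a => ∫⁻ b, F (a, b) ∂(P.map V)) hF.lintegral_prod_right' hY]

/-! ### The transition operator between losses -/

/-- Rate at which the discounted payoff is collected at time `s` along the flow from `y`. -/
noncomputable def payDensity (φ : ℝ → ℝ → ℝ) (k v : ℝ → ℝ) (δ y s : ℝ) : ℝ≥0∞ :=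
  ENNReal.ofReal (rateAlong φ k y s) * (ENNReal.ofReal (Real.exp (-cumKill φ k y s)) *
    ENNReal.ofReal (Real.exp (-δ * s) * v (φ s y)))

/-- Expected discounted payoff collected before the first loss. -/
noncomputable def firstPay (φ : ℝ → ℝ → ℝ) (k v : ℝ → ℝ) (δ lam y : ℝ) : ℝ≥0∞ :=
  ∫⁻ t, (∫⁻ s in Set.Ioc 0 t, payDensity φ k v δ y s) ∂(expMeasure lam)

/-- Discounted transition operator of the levels just after the losses. -/
noncomputable def stepOp (φ : ℝ → ℝ → ℝ) (k : ℝ → ℝ) (δ lam : ℝ) (G : Measure ℝ)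
    (f : ℝ → ℝ≥0∞) (y : ℝ) : ℝ≥0∞ :=
  ∫⁻ t, ENNReal.ofReal (Real.exp (-cumKill φ k y t - δ * t)) *
    ∫⁻ z, f (z * φ t y) ∂G ∂(expMeasure lam)

/-- Expected discounted payoff as a series over the number of losses. -/
noncomputable def value (φ : ℝ → ℝ → ℝ) (k v : ℝ → ℝ) (δ lam : ℝ) (G : Measure ℝ) (x : ℝ) :
    ℝ≥0∞ :=
  ∑' n, (stepOp φ k δ lam G)^[n] (firstPay φ k v δ lam) x

section Operator

variable {φ : ℝ → ℝ → ℝ} {k v : ℝ → ℝ} {δ lam : ℝ} {G : Measure ℝ}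

theorem measurable_payDensity (h : IsGrowthFlow φ) (hk : IsKillingRate k) (hv : Measurable v) :
    Measurable fun p : ℝ × ℝ => payDensity φ k v δ p.1 p.2 := by
  refine (measurable_rateAlong h hk).ennreal_ofReal.mul
    ((Real.measurable_exp.comp (measurable_cumKill h hk).neg).ennreal_ofReal.mul
    (Measurable.ennreal_ofReal ?_))
  exact (Real.measurable_exp.comp (measurable_snd.const_mul _)).mul
    (hv.comp (h.measurable.comp measurable_swap))

theorem measurable_lintegral_payDensity (h : IsGrowthFlow φ) (hk : IsKillingRate k)
    (hv : Measurable v) :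
    Measurable fun p : ℝ × ℝ => ∫⁻ s in Set.Ioc 0 p.2, payDensity φ k v δ p.1 s := by
  have h1 : Measurable fun q : (ℝ × ℝ) × ℝ =>
      if 0 < q.2 ∧ q.2 ≤ q.1.2 then payDensity φ k v δ q.1.1 q.2 else 0 := by
    refine Measurable.ite ?_ ((measurable_payDensity h hk hv).comp
      ((measurable_fst.comp measurable_fst).prodMk measurable_snd)) measurable_const
    exact (measurableSet_lt measurable_const measurable_snd).inter
      (measurableSet_le measurable_snd (measurable_snd.comp measurable_fst))
  have h2 := h1.lintegral_prod_right' (ν := (volume : Measure ℝ))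
  convert h2 using 2 with p
  rw [← lintegral_indicator measurableSet_Ioc]
  simp only [Set.indicator_apply, Set.mem_Ioc]

theorem measurable_firstPay [SFinite (expMeasure lam)] (h : IsGrowthFlow φ) (hk : IsKillingRate k)
    (hv : Measurable v) : Measurable (firstPay φ k v δ lam) :=
  (measurable_lintegral_payDensity h hk hv).lintegral_prod_right'

theorem measurable_stepOp [SFinite (expMeasure lam)] [SFinite G] (h : IsGrowthFlow φ)
    (hk : IsKillingRate k) {f : ℝ → ℝ≥0∞} (hf : Measurable f) :
    Measurable (stepOp φ k δ lam G f) := by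
  have h1 : Measurable fun p : ℝ × ℝ => ∫⁻ z, f (z * φ p.2 p.1) ∂G := by
    have : Measurable fun q : (ℝ × ℝ) × ℝ => f (q.2 * φ q.1.2 q.1.1) :=
      hf.comp (measurable_snd.mul (h.measurable.comp (measurable_swap.comp measurable_fst)))
    exact this.lintegral_prod_right'
  have h2 : Measurable fun p : ℝ × ℝ => ENNReal.ofReal
      (Real.exp (-cumKill φ k p.1 p.2 - δ * p.2)) * ∫⁻ z, f (z * φ p.2 p.1) ∂G :=
    (Real.measurable_exp.comp ((measurable_cumKill h hk).neg.sub
      (measurable_snd.const_mul δ))).ennreal_ofReal.mul h1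
  exact h2.lintegral_prod_right'

theorem measurable_stepOp_iterate [SFinite (expMeasure lam)] [SFinite G] (h : IsGrowthFlow φ)
    (hk : IsKillingRate k) {f : ℝ → ℝ≥0∞} (hf : Measurable f) (n : ℕ) :
    Measurable ((stepOp φ k δ lam G)^[n] f) := by
  induction n with
  | zero => exact hf
  | succ n ih => rw [Function.iterate_succ_apply']; exact measurable_stepOp h hk ih

theorem measurable_value [SFinite (expMeasure lam)] [SFinite G] (h : IsGrowthFlow φ)
    (hk : IsKillingRate k) (hv : Measurable v) : Measurable (value φ k v δ lam G) :=
  Measurable.tsum fun n =>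
    measurable_stepOp_iterate h hk (measurable_firstPay h hk hv) n

/-- The renewal equation. -/
theorem value_eq [SFinite (expMeasure lam)] [SFinite G] (h : IsGrowthFlow φ)
    (hk : IsKillingRate k) (hv : Measurable v) (y : ℝ) :
    value φ k v δ lam G y = firstPay φ k v δ lam y
      + stepOp φ k δ lam G (value φ k v δ lam G) y := by
  have hm := measurable_stepOp_iterate (δ := δ) (lam := lam) (G := G) h hk
    (measurable_firstPay (δ := δ) (lam := lam) h hk hv)
  have hflow : Measurable fun t => φ t y := h.measurable.comp measurable_prodMk_right
  have hcum : Measurable fun t => cumKill φ k y t :=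
    (measurable_cumKill h hk).comp measurable_prodMk_left
  -- The zeroth term is the payoff before the first loss; the others form `stepOp` applied to the
  -- series, since the operator commutes with countable sums of nonnegative functions.
  conv_lhs => rw [value, tsum_eq_zero_add' ENNReal.summable]
  simp only [Function.iterate_zero, id_eq, Function.iterate_succ_apply']
  congr 1
  simp only [stepOp, value]
  rw [← lintegral_tsum]
  · refine lintegral_congr fun t => ?_
    rw [ENNReal.tsum_mul_left, lintegral_tsum]
    intro n
    exact ((hm n).comp (measurable_id.mul_const _)).aemeasurable
  · intro n
    refine Measurable.aemeasurable (Measurable.mul ?_ ?_)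
    · exact (Real.measurable_exp.comp (hcum.neg.sub (measurable_id.const_mul δ))).ennreal_ofReal
    · have : Measurable fun q : ℝ × ℝ => (stepOp φ k δ lam G)^[n] (firstPay φ k v δ lam)
          (q.2 * φ q.1 y) := (hm n).comp (measurable_snd.mul (hflow.comp measurable_fst))
      exact this.lintegral_prod_right'

/-- Memorylessness of the killing level: shifting by the rate `c` already accumulated costs a factor
`exp (-c)`, after which `lintegral_Ioc_cumKill` turns the level into time. -/
theorem lintegral_exp_killPay (h : IsGrowthFlow φ) (hk : IsKillingRate k) (hv : Measurable v)
    {y c t T : ℝ} (hy : 0 < y) (hc : 0 ≤ c) (ht : 0 ≤ t) :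
    ∫⁻ e, (if c < e ∧ e ≤ c + cumKill φ k y t then
        ENNReal.ofReal (Real.exp (-δ * T)) * killPay φ k v δ y (e - c) else 0) ∂(expMeasure 1)
      = ENNReal.ofReal (Real.exp (-c - δ * T)) * ∫⁻ s in Set.Ioc 0 t, payDensity φ k v δ y s := by
  have hpay : Measurable fun e => killPay φ k v δ y e :=
    Measurable.comp (g := fun p : ℝ × ℝ => killPay φ k v δ p.1 p.2) (f := Prod.mk y)
      (measurable_killPay h hk hv) measurable_prodMk_left
  have hset : MeasurableSet {e : ℝ | c < e ∧ e ≤ c + cumKill φ k y t} := measurableSet_Ioc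
  have hmeas : Measurable fun e : ℝ => if c < e ∧ e ≤ c + cumKill φ k y t then
      ENNReal.ofReal (Real.exp (-δ * T)) * killPay φ k v δ y (e - c) else 0 :=
    Measurable.ite hset ((hpay.comp (measurable_id.sub_const c)).const_mul _) measurable_const
  have hexp : Measurable fun u : ℝ => ENNReal.ofReal (Real.exp (-u)) :=
    (Real.measurable_exp.comp measurable_neg).ennreal_ofReal
  have hprod : Measurable fun u => ENNReal.ofReal (Real.exp (-u)) * killPay φ k v δ y u :=
    hexp.mul hpay
  simp only [payDensity]
  rw [lintegral_expMeasure 1 hmeas, ← lintegral_Ioc_cumKill h hk hy ht,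
    ← lintegral_const_mul _ hprod, ← lintegral_indicator measurableSet_Ioi,
    ← lintegral_indicator measurableSet_Ioc]
  refine (lintegral_add_right_eq_self _ c).symm.trans (lintegral_congr fun u => ?_)
  by_cases hu : u ∈ Set.Ioc 0 (cumKill φ k y t)
  · have hu1 := hu.1
    have hu2 := hu.2
    rw [Set.indicator_of_mem hu, Set.indicator_of_mem (Set.mem_Ioi.2 (by linarith)),
      if_pos ⟨by linarith, by linarith⟩, add_sub_cancel_right, ← mul_assoc, ← mul_assoc,
      ← ENNReal.ofReal_mul (by positivity), ← ENNReal.ofReal_mul (by positivity), one_mul,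
      ← Real.exp_add, ← Real.exp_add]
    congr 3
    ring
  · rw [Set.indicator_of_notMem hu, Set.indicator_apply_eq_zero]
    intro _
    rw [if_neg, mul_zero]
    rintro ⟨h1, h2⟩
    exact hu ⟨by linarith, by linarith⟩

end Operator

/-! ### Independence of the past and the next inputs -/

section Past

variable {Ω : Type*} {W Z : ℕ → Ω → ℝ} {φ : ℝ → ℝ → ℝ} {k : ℝ → ℝ}

/-- Level, accumulated rate and time at the `n`-th loss. -/
noncomputable def lossState (φ : ℝ → ℝ → ℝ) (k : ℝ → ℝ) (W Z : ℕ → Ω → ℝ) (x : ℝ) (n : ℕ) (o : Ω) :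
    ℝ × ℝ × ℝ :=
  (postLevel φ (fun i => W i o) (fun i => Z i o) x n,
    killAt φ k (fun i => W i o) (fun i => Z i o) x n, lossTime (fun i => W i o) n)

/-- The σ-algebra generated by a single input. -/
abbrev inputField (W Z : ℕ → Ω → ℝ) (E : Ω → ℝ) (i : ℕ ⊕ ℕ ⊕ Unit) : MeasurableSpace Ω :=
  MeasurableSpace.comap (Sum.elim W (Sum.elim Z fun _ : Unit => E) i) Real.measurableSpace

/-- Indices of the inputs used before the `n`-th loss. -/
def pastIndex (n : ℕ) : Set (ℕ ⊕ ℕ ⊕ Unit) :=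
  {i | Sum.elim (· < n) (Sum.elim (· < n) fun _ => False) i}

/-- The state at the `n`-th loss is built from `W i`, `Z i` with `i < n` alone. This adaptedness
makes it independent of `W n`, `Z n` and `E`, and replaces the Markov property. -/
theorem measurable_lossState_past (E : Ω → ℝ) (h : IsGrowthFlow φ) (hk : IsKillingRate k) (x : ℝ) (n : ℕ) :
    Measurable[⨆ i ∈ pastIndex n, inputField W Z E i] (lossState φ k W Z x n) := by
  induction n with
  | zero =>
    have : lossState φ k W Z x 0 = fun _ => (x, 0, 0) := by
      funext o
      simp [lossState, postLevel, killAt, lossTime]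
    rw [this]
    exact measurable_const
  | succ n ih =>
    set f := Sum.elim W (Sum.elim Z fun _ : Unit => E) with hf
    set m := ⨆ i ∈ pastIndex (n + 1), inputField W Z E i with hm
    have hle : (⨆ i ∈ pastIndex n, inputField W Z E i) ≤ m := by
      refine biSup_mono fun i hi => ?_
      rcases i with i | i | i
      · exact Nat.lt_succ_of_lt hi
      · exact Nat.lt_succ_of_lt hi
      · exact hi
    have hY : Measurable[m] (lossState φ k W Z x n) := ih.mono hle le_rfl
    have hWn : Measurable[m] (W n) := Measurable.mono (comap_measurable (f (Sum.inl n)))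
      (le_biSup (inputField W Z E)
        (show Sum.inl n ∈ pastIndex (n + 1) from Nat.lt_succ_self n)) le_rfl
    have hZn : Measurable[m] (Z n) := Measurable.mono (comap_measurable (f (Sum.inr (Sum.inl n))))
      (le_biSup (inputField W Z E)
        (show Sum.inr (Sum.inl n) ∈ pastIndex (n + 1) from Nat.lt_succ_self n)) le_rfl
    have hX := measurable_fst.comp hY
    have hC := (measurable_fst.comp measurable_snd).comp hY
    have hT := (measurable_snd.comp measurable_snd).comp hY
    have e1 := hZn.mul (h.measurable.comp (hWn.prodMk hX))
    have e2 := hC.add ((measurable_cumKill h hk).comp (hX.prodMk hWn))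
    have e3 := hT.add hWn
    refine Measurable.prodMk e1 (Measurable.prodMk e2 ?_)
    convert e3 using 2 with o
    exact lossTime_succ _ _

end Past

/-- Independent inputs: waiting times, proportions and the killing level. -/
structure IsInput {Ω : Type*} [MeasurableSpace Ω] (P : Measure Ω) (lam : ℝ) (G : Measure ℝ)
    (W Z : ℕ → Ω → ℝ) (E : Ω → ℝ) : Prop where
  measurable_W : ∀ n, Measurable (W n)
  measurable_Z : ∀ n, Measurable (Z n)
  measurable_E : Measurable E
  map_W : ∀ n, P.map (W n) = expMeasure lam
  map_Z : ∀ n, P.map (Z n) = G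
  map_E : P.map E = expMeasure 1
  indep : iIndepFun (Sum.elim W (Sum.elim Z fun _ : Unit => E)) P

section Input

variable {Ω : Type*} [mΩ : MeasurableSpace Ω] {P : Measure Ω} {lam : ℝ}
  {G : Measure ℝ} {W Z : ℕ → Ω → ℝ} {E : Ω → ℝ} {φ : ℝ → ℝ → ℝ} {k v : ℝ → ℝ} {δ : ℝ}

theorem IsInput.comap_le (hI : IsInput P lam G W Z E) (i : ℕ ⊕ ℕ ⊕ Unit) :
    inputField W Z E i ≤ mΩ := by
  rcases i with i | i | i
  · exact (hI.measurable_W i).comap_le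
  · exact (hI.measurable_Z i).comap_le
  · exact hI.measurable_E.comap_le

theorem IsInput.measurable_lossState (hI : IsInput P lam G W Z E) (h : IsGrowthFlow φ)
    (hk : IsKillingRate k) (x : ℝ) (n : ℕ) : Measurable (lossState φ k W Z x n) :=
  (measurable_lossState_past E h hk x n).mono (iSup₂_le fun i _ => hI.comap_le i) le_rfl

theorem IsInput.indepFun_lossState (hI : IsInput P lam G W Z E) (h : IsGrowthFlow φ)
    (hk : IsKillingRate k) (x : ℝ) (n : ℕ) {i j : ℕ ⊕ ℕ ⊕ Unit} (hi : i ∉ pastIndex n)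
    (hj : j ∉ pastIndex n) :
    IndepFun (lossState φ k W Z x n) (fun o => (Sum.elim W (Sum.elim Z fun _ : Unit => E) i o,
      Sum.elim W (Sum.elim Z fun _ : Unit => E) j o)) P := by
  have hdisj : Disjoint (pastIndex n) {i, j} := by
    rw [Set.disjoint_right]
    rintro a (rfl | rfl)
    · exact hi
    · exact hj
  have := indep_iSup_of_disjoint hI.comap_le ((iIndepFun_iff_iIndep _ _ P).1 hI.indep) hdisj
  rw [IndepFun_iff_Indep]
  refine indep_of_indep_of_le this (measurable_lossState_past E h hk x n).comap_le ?_
  refine Measurable.comap_le (Measurable.prodMk ?_ ?_)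
  · exact Measurable.mono (comap_measurable _)
      (le_biSup (inputField W Z E) (Set.mem_insert i {j})) le_rfl
  · exact Measurable.mono (comap_measurable _)
      (le_biSup (inputField W Z E) (Set.mem_insert_of_mem i rfl)) le_rfl

theorem IsInput.lintegral_next_W_E [IsProbabilityMeasure P] (hI : IsInput P lam G W Z E) (h : IsGrowthFlow φ)
    (hk : IsKillingRate k) (x : ℝ) (n : ℕ) {F : (ℝ × ℝ × ℝ) × ℝ × ℝ → ℝ≥0∞} (hF : Measurable F) :
    ∫⁻ o, F (lossState φ k W Z x n o, W n o, E o) ∂P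
      = ∫⁻ o, ∫⁻ t, ∫⁻ e, F (lossState φ k W Z x n o, t, e) ∂(expMeasure 1) ∂(expMeasure lam)
          ∂P := by
  have h1 := hI.indepFun_lossState (i := Sum.inl n) (j := Sum.inr (Sum.inr ())) h hk x n
    (by simp [pastIndex]) (by simp [pastIndex])
  have h2 : IndepFun (W n) E P := hI.indep.indepFun (i := Sum.inl n) (j := Sum.inr (Sum.inr ()))
    (by simp)
  have h3 := (indepFun_iff_map_prod_eq_prod_map_map (hI.measurable_W n).aemeasurable
    hI.measurable_E.aemeasurable).1 h2
  rw [hI.map_W, hI.map_E] at h3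
  have : IsProbabilityMeasure (expMeasure 1) := isProbabilityMeasure_expMeasure one_pos
  rw [lintegral_indepFun (V := fun o => (W n o, E o)) (hI.measurable_lossState h hk x n)
    ((hI.measurable_W n).prodMk hI.measurable_E) h1 hF, h3]
  refine lintegral_congr fun o => ?_
  exact lintegral_prod (fun b => F (lossState φ k W Z x n o, b))
    (hF.comp measurable_prodMk_left).aemeasurable

theorem IsInput.lintegral_next_W_Z [IsProbabilityMeasure P] [SFinite G] (hI : IsInput P lam G W Z E) (h : IsGrowthFlow φ)
    (hk : IsKillingRate k) (x : ℝ) (n : ℕ) {F : (ℝ × ℝ × ℝ) × ℝ × ℝ → ℝ≥0∞} (hF : Measurable F) :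
    ∫⁻ o, F (lossState φ k W Z x n o, W n o, Z n o) ∂P
      = ∫⁻ o, ∫⁻ t, ∫⁻ z, F (lossState φ k W Z x n o, t, z) ∂G ∂(expMeasure lam) ∂P := by
  have h1 := hI.indepFun_lossState (i := Sum.inl n) (j := Sum.inr (Sum.inl n)) h hk x n
    (by simp [pastIndex]) (by simp [pastIndex])
  have h2 : IndepFun (W n) (Z n) P :=
    hI.indep.indepFun (i := Sum.inl n) (j := Sum.inr (Sum.inl n)) (by simp)
  have h3 := (indepFun_iff_map_prod_eq_prod_map_map (hI.measurable_W n).aemeasurable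
    (hI.measurable_Z n).aemeasurable).1 h2
  rw [hI.map_W, hI.map_Z] at h3
  rw [lintegral_indepFun (V := fun o => (W n o, Z n o)) (hI.measurable_lossState h hk x n)
    ((hI.measurable_W n).prodMk (hI.measurable_Z n)) h1 hF, h3]
  refine lintegral_congr fun o => ?_
  exact lintegral_prod (fun b => F (lossState φ k W Z x n o, b))
    (hF.comp measurable_prodMk_left).aemeasurable

theorem IsInput.ae_W_pos (hI : IsInput P lam G W Z E) : ∀ᵐ o ∂P, ∀ n, 0 < W n o := by
  rw [ae_all_iff]
  intro n
  have := ae_expMeasure_pos lam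
  rw [← hI.map_W n] at this
  exact ae_of_ae_map (hI.measurable_W n).aemeasurable this

theorem IsInput.ae_E_pos (hI : IsInput P lam G W Z E) : ∀ᵐ o ∂P, 0 < E o := by
  have := ae_expMeasure_pos 1
  rw [← hI.map_E] at this
  exact ae_of_ae_map hI.measurable_E.aemeasurable this

theorem IsInput.ae_Z_mem (hI : IsInput P lam G W Z E) (hG : ∀ᵐ z ∂G, z ∈ Set.Ioc (0 : ℝ) 1) :
    ∀ᵐ o ∂P, ∀ n, Z n o ∈ Set.Ioc (0 : ℝ) 1 := by
  rw [ae_all_iff]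
  intro n
  rw [← hI.map_Z n] at hG
  exact ae_of_ae_map (hI.measurable_Z n).aemeasurable hG

/-- One loss at a time: with the state at loss `n` frozen, integrating out `W n` and `Z n` replaces
`f` by `stepOp f`. The last loss is removed first, so the induction must range over all `f`. -/
theorem IsInput.lintegral_iterate [IsProbabilityMeasure P] [SFinite G] (hI : IsInput P lam G W Z E)
    (h : IsGrowthFlow φ) (hk : IsKillingRate k) (x : ℝ) (n : ℕ) {f : ℝ → ℝ≥0∞}
    (hf : Measurable f) :
    ∫⁻ o, ENNReal.ofReal (Real.exp (-(lossState φ k W Z x n o).2.1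
        - δ * (lossState φ k W Z x n o).2.2)) * f (lossState φ k W Z x n o).1 ∂P
      = (stepOp φ k δ lam G)^[n] f x := by
  have hsf : SFinite (expMeasure lam) := by rw [← hI.map_W 0]; infer_instance
  induction n generalizing f with
  | zero => simp [lossState, postLevel, killAt, lossTime]
  | succ n ih =>
    rw [Function.iterate_succ_apply, ← ih (measurable_stepOp h hk hf)]
    have hcum : Measurable fun q : (ℝ × ℝ × ℝ) × ℝ × ℝ => cumKill φ k q.1.1 q.2.1 :=
      (measurable_cumKill h hk).comp
        ((measurable_fst.comp measurable_fst).prodMk (measurable_fst.comp measurable_snd))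
    have hfl : Measurable fun q : (ℝ × ℝ × ℝ) × ℝ × ℝ => φ q.2.1 q.1.1 := h.measurable.comp
        ((measurable_fst.comp measurable_snd).prodMk (measurable_fst.comp measurable_fst))
    have hF : Measurable fun q : (ℝ × ℝ × ℝ) × ℝ × ℝ =>
        ENNReal.ofReal (Real.exp (-(q.1.2.1 + cumKill φ k q.1.1 q.2.1) - δ * (q.1.2.2 + q.2.1))) *
          f (q.2.2 * φ q.2.1 q.1.1) := by
      refine (Real.measurable_exp.comp ?_).ennreal_ofReal.mul
        (hf.comp ((measurable_snd.comp measurable_snd).mul hfl))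
      fun_prop
    have hkey := hI.lintegral_next_W_Z h hk x n hF
    have hl : ∀ o, lossState φ k W Z x (n + 1) o
        = (Z n o * φ (W n o) (lossState φ k W Z x n o).1,
          (lossState φ k W Z x n o).2.1 + cumKill φ k (lossState φ k W Z x n o).1 (W n o),
          (lossState φ k W Z x n o).2.2 + W n o) := by
      intro o
      simp only [lossState, postLevel, killAt, lossTime_succ]
    simp only [hl]
    rw [hkey]
    refine lintegral_congr fun o => ?_
    set Y := lossState φ k W Z x n o
    have hc1 : Measurable fun t => cumKill φ k Y.1 t :=
      (measurable_cumKill h hk).comp measurable_prodMk_left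
    have hf1 : Measurable fun q : ℝ × ℝ => f (q.2 * φ q.1 Y.1) :=
      hf.comp (measurable_snd.mul (h.measurable.comp (measurable_fst.prodMk measurable_const)))
    rw [stepOp, ← lintegral_const_mul]
    · refine lintegral_congr fun t => ?_
      have hf2 : Measurable fun z => f (z * φ t Y.1) := hf1.comp measurable_prodMk_left
      simp only
      rw [lintegral_const_mul _ hf2, ← mul_assoc,
        ← ENNReal.ofReal_mul (Real.exp_pos _).le, ← Real.exp_add]
      congr 3
      ring
    · exact (Real.measurable_exp.comp (hc1.neg.sub
        (measurable_id.const_mul δ))).ennreal_ofReal.mul hf1.lintegral_prod_right'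

/-- The `n`-th term depends on the state at the `n`-th loss, on `W n` and on `E`. Integrating out
the last two leaves the weight of the state times `firstPay` at its level, to which
`lintegral_iterate` applies. -/
theorem IsInput.lintegral_penaltySum [IsProbabilityMeasure P] [SFinite G] (hI : IsInput P lam G W Z E)
    (hG : ∀ᵐ z ∂G, z ∈ Set.Ioc (0 : ℝ) 1) (h : IsGrowthFlow φ) (hk : IsKillingRate k)
    (hv : Measurable v) {x : ℝ} (hx : 0 < x) :
    Measurable (fun o => penaltySum φ k v δ (fun i => W i o) (fun i => Z i o) x (E o)) ∧
    ∫⁻ o, penaltySum φ k v δ (fun i => W i o) (fun i => Z i o) x (E o) ∂P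
      = value φ k v δ lam G x := by
  have hsf : SFinite (expMeasure lam) := by rw [← hI.map_W 0]; infer_instance
  set F : (ℝ × ℝ × ℝ) × ℝ × ℝ → ℝ≥0∞ := fun q =>
    if q.1.2.1 < q.2.2 ∧ q.2.2 ≤ q.1.2.1 + cumKill φ k q.1.1 q.2.1 then
      ENNReal.ofReal (Real.exp (-δ * q.1.2.2)) * killPay φ k v δ q.1.1 (q.2.2 - q.1.2.1) else 0
    with hFdef
  have hcum : Measurable fun q : (ℝ × ℝ × ℝ) × ℝ × ℝ => cumKill φ k q.1.1 q.2.1 :=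
    (measurable_cumKill h hk).comp
      ((measurable_fst.comp measurable_fst).prodMk (measurable_fst.comp measurable_snd))
  have hF : Measurable F := by
    refine Measurable.ite ?_ (Measurable.fun_mul ?_ ?_) measurable_const
    · have h1 : Measurable fun q : (ℝ × ℝ × ℝ) × ℝ × ℝ => q.1.2.1 := by fun_prop
      have h2 : Measurable fun q : (ℝ × ℝ × ℝ) × ℝ × ℝ => q.2.2 := by fun_prop
      exact (measurableSet_lt h1 h2).inter (measurableSet_le h2 (h1.add hcum))
    · exact (Real.measurable_exp.comp (by fun_prop)).ennreal_ofReal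
    · exact (measurable_killPay h hk hv).comp (f := fun q : (ℝ × ℝ × ℝ) × ℝ × ℝ =>
        (q.1.1, q.2.2 - q.1.2.1)) (by fun_prop)
  have hterm : ∀ n o, (if killAt φ k (fun i => W i o) (fun i => Z i o) x n < E o ∧
      E o ≤ killAt φ k (fun i => W i o) (fun i => Z i o) x (n + 1) then
      ENNReal.ofReal (Real.exp (-δ * lossTime (fun i => W i o) n)) *
        killPay φ k v δ (postLevel φ (fun i => W i o) (fun i => Z i o) x n)
          (E o - killAt φ k (fun i => W i o) (fun i => Z i o) x n) else 0)
      = F (lossState φ k W Z x n o, W n o, E o) := fun n o => rfl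
  have hmn : ∀ n, Measurable fun o => F (lossState φ k W Z x n o, W n o, E o) := fun n =>
    hF.comp ((hI.measurable_lossState h hk x n).prodMk
      ((hI.measurable_W n).prodMk hI.measurable_E))
  simp only [penaltySum, hterm]
  refine ⟨Measurable.tsum hmn, ?_⟩
  rw [lintegral_tsum fun n => (hmn n).aemeasurable, value]
  congr 1 with n
  rw [hI.lintegral_next_W_E h hk x n hF, ← hI.lintegral_iterate h hk x n
    (measurable_firstPay h hk hv)]
  refine lintegral_congr_ae ?_
  filter_upwards [hI.ae_W_pos, hI.ae_Z_mem hG] with o hWo hZo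
  have hpos : 0 < (lossState φ k W Z x n o).1 :=
    postLevel_pos h hWo (fun n => (hZo n).1) hx n
  have hc0 : 0 ≤ (lossState φ k W Z x n o).2.1 := killAt_nonneg hk hWo n
  rw [firstPay, ← lintegral_const_mul]
  · refine lintegral_congr_ae ?_
    filter_upwards [ae_expMeasure_pos lam] with t ht
    exact lintegral_exp_killPay h hk hv hpos hc0 ht.le
  · exact (measurable_lintegral_payDensity h hk hv).comp measurable_prodMk_left

/-- The level `E` is independent of the loss chain and its law has no atoms, so ties have
probability zero. -/
theorem IsInput.ae_ne_killAt [IsProbabilityMeasure P] (hI : IsInput P lam G W Z E) (h : IsGrowthFlow φ)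
    (hk : IsKillingRate k) (x : ℝ) :
    ∀ᵐ o ∂P, ∀ n, E o ≠ killAt φ k (fun i => W i o) (fun i => Z i o) x n := by
  rw [ae_all_iff]
  intro n
  have hset : MeasurableSet {q : (ℝ × ℝ × ℝ) × ℝ × ℝ | q.2.2 = q.1.2.1} :=
    measurableSet_eq_fun (by fun_prop) (by fun_prop)
  have h1 := hI.lintegral_next_W_E h hk x n
    (F := {q : (ℝ × ℝ × ℝ) × ℝ × ℝ | q.2.2 = q.1.2.1}.indicator 1)
    (measurable_const.indicator hset)
  have h2 : ∀ o t, ∫⁻ e, ({q : (ℝ × ℝ × ℝ) × ℝ × ℝ | q.2.2 = q.1.2.1}.indicator 1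
      (lossState φ k W Z x n o, t, e) : ℝ≥0∞) ∂(expMeasure 1) = 0 := by
    intro o t
    have : ∀ e, ({q : (ℝ × ℝ × ℝ) × ℝ × ℝ | q.2.2 = q.1.2.1}.indicator 1
        (lossState φ k W Z x n o, t, e) : ℝ≥0∞)
        = ({(lossState φ k W Z x n o).2.1} : Set ℝ).indicator 1 e := by
      intro e
      simp [Set.indicator_apply]
    simp only [this]
    rw [lintegral_indicator_one (measurableSet_singleton _), expMeasure_singleton]
  simp only [h2, lintegral_zero] at h1
  rw [lintegral_eq_zero_iff] at h1
  · filter_upwards [h1] with o ho heq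
    have : (lossState φ k W Z x n o, W n o, E o) ∈ {q : (ℝ × ℝ × ℝ) × ℝ × ℝ | q.2.2 = q.1.2.1} :=
      heq
    simp [Set.indicator_of_mem this] at ho
  · exact (measurable_const.indicator hset).comp ((hI.measurable_lossState h hk x n).prodMk
      ((hI.measurable_W n).prodMk hI.measurable_E))

end Input

end KilledFlow

/-! ### The renewal equation as an integral equation along the flow. -/

namespace KilledFlow

/-- Rate at which payoff and post-loss value are collected at the level `u`. -/
noncomputable def source (φ : ℝ → ℝ → ℝ) (k v : ℝ → ℝ) (δ lam : ℝ) (G : Measure ℝ) (u : ℝ) : ℝ :=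
  k u * v u + lam * ∫ z, (value φ k v δ lam G (z * u)).toReal ∂G

section Value

variable {φ : ℝ → ℝ → ℝ} {k v : ℝ → ℝ} {δ lam C : ℝ} {G : Measure ℝ}

theorem lintegral_Ici_exp (hlam : 0 < lam) (s : ℝ) :
    ∫⁻ t in Set.Ici s, ENNReal.ofReal (lam * Real.exp (-(lam * t)))
      = ENNReal.ofReal (Real.exp (-(lam * s))) := by
  have hneg : -lam < 0 := neg_neg_of_pos hlam
  have h1 := integral_exp_mul_Ioi hneg s
  have h2 := integrableOn_exp_mul_Ioi hneg s
  simp only [neg_mul] at h1 h2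
  rw [setLIntegral_congr Ioi_ae_eq_Ici.symm, ← ofReal_integral_eq_lintegral_ofReal
    (h2.const_mul lam) (ae_of_all _ fun t => by positivity), integral_const_mul, h1]
  congr 1
  field_simp

/-- Tonelli: the payoff at time `s` is collected when the first loss comes after `s`, which has
probability `exp (-(lam * s))`. -/
theorem firstPay_eq (h : IsGrowthFlow φ) (hk : IsKillingRate k) (hv : Measurable v)
    (hlam : 0 < lam) (y : ℝ) :
    firstPay φ k v δ lam y
      = ∫⁻ s in Set.Ioi 0, ENNReal.ofReal (Real.exp (-(lam * s))) * payDensity φ k v δ y s := by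
  have hpd : Measurable fun s => payDensity φ k v δ y s :=
    (measurable_payDensity h hk hv).comp measurable_prodMk_left
  have hint : Measurable fun t => ∫⁻ s in Set.Ioc 0 t, payDensity φ k v δ y s :=
    (measurable_lintegral_payDensity h hk hv).comp measurable_prodMk_left
  have hexp : Measurable fun t : ℝ => ENNReal.ofReal (lam * Real.exp (-(lam * t))) := by fun_prop
  have hset : MeasurableSet {p : ℝ × ℝ | 0 < p.2 ∧ p.2 ≤ p.1} :=
    (measurableSet_lt measurable_const measurable_snd).inter
      (measurableSet_le measurable_snd measurable_fst)
  set F : ℝ → ℝ → ℝ≥0∞ := fun t s => if 0 < s ∧ s ≤ t then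
    ENNReal.ofReal (lam * Real.exp (-(lam * t))) * payDensity φ k v δ y s else 0 with hF
  have hFm : Measurable (Function.uncurry F) :=
    Measurable.ite hset ((hexp.comp measurable_fst).mul (hpd.comp measurable_snd))
      measurable_const
  have e1 : firstPay φ k v δ lam y = ∫⁻ t, ∫⁻ s, F t s := by
    rw [firstPay, lintegral_expMeasure lam hint, ← lintegral_indicator measurableSet_Ioi]
    refine lintegral_congr fun t => ?_
    by_cases ht : 0 < t
    · rw [Set.indicator_of_mem (Set.mem_Ioi.2 ht), ← lintegral_const_mul _ hpd,
        ← lintegral_indicator measurableSet_Ioc]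
      refine lintegral_congr fun s => ?_
      simp only [hF, Set.indicator_apply, Set.mem_Ioc]
    · rw [Set.indicator_of_notMem (by simpa using ht)]
      refine (lintegral_eq_zero_of_ae_eq_zero (ae_of_all _ fun s => if_neg ?_)).symm
      rintro ⟨h1, h2⟩
      exact ht (h1.trans_le h2)
  rw [e1, lintegral_lintegral_swap hFm.aemeasurable, ← lintegral_indicator measurableSet_Ioi]
  refine lintegral_congr fun s => ?_
  by_cases hs : 0 < s
  · rw [Set.indicator_of_mem (Set.mem_Ioi.2 hs), ← lintegral_Ici_exp hlam,
      ← lintegral_mul_const _ hexp, ← lintegral_indicator measurableSet_Ici]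
    refine lintegral_congr fun t => ?_
    simp only [hF, Set.indicator_apply, Set.mem_Ici, hs, true_and]
  · rw [Set.indicator_of_notMem (by simpa using hs)]
    simp [hF, hs]

theorem payDensity_eq (hk : IsKillingRate k) (hv0 : ∀ y, 0 ≤ v y) {y s : ℝ} (hs : 0 ≤ s) :
    payDensity φ k v δ y s = ENNReal.ofReal (Real.exp (-cumKill φ k y s - δ * s)) *
      ENNReal.ofReal (k (φ s y) * v (φ s y)) := by
  have := hv0 (φ s y)
  have := hk.nonneg (φ s y)
  rw [payDensity, rateAlong_of_nonneg hs, ← ENNReal.ofReal_mul (by positivity),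
    ← ENNReal.ofReal_mul (by positivity), ← ENNReal.ofReal_mul (by positivity), sub_eq_add_neg,
    Real.exp_add, ← neg_mul]
  congr 1
  ring

theorem ofReal_source [IsProbabilityMeasure G] [SFinite (expMeasure lam)] (h : IsGrowthFlow φ)
    (hk : IsKillingRate k) (hv : Measurable v) (hv0 : ∀ y, 0 ≤ v y) (hlam : 0 < lam)
    (hG : ∀ᵐ z ∂G, z ∈ Set.Ioc (0 : ℝ) 1)
    (hV : ∀ y, 0 < y → value φ k v δ lam G y ≤ ENNReal.ofReal C) {u : ℝ} (hu : 0 < u) :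
    ENNReal.ofReal (source φ k v δ lam G u) = ENNReal.ofReal (k u * v u)
      + ENNReal.ofReal lam * ∫⁻ z, value φ k v δ lam G (z * u) ∂G := by
  have hm : Measurable fun z => value φ k v δ lam G (z * u) :=
    (measurable_value h hk hv).comp (measurable_id.mul_const u)
  have hle : ∀ᵐ z ∂G, value φ k v δ lam G (z * u) ≤ ENNReal.ofReal C := by
    filter_upwards [hG] with z hz using hV _ (mul_pos hz.1 hu)
  have hfin : ∫⁻ z, value φ k v δ lam G (z * u) ∂G ≠ ∞ := by
    refine ((lintegral_mono_ae hle).trans_lt ?_).ne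
    simp
  rw [source, ENNReal.ofReal_add (mul_nonneg (hk.nonneg _) (hv0 _)) (by positivity),
    ENNReal.ofReal_mul hlam.le, integral_toReal hm.aemeasurable
      (hle.mono fun z hz => hz.trans_lt ENNReal.ofReal_lt_top), ENNReal.ofReal_toReal hfin]

/-- The value as an integral along the flow. -/
theorem value_eq_lintegral [IsProbabilityMeasure G] [SFinite (expMeasure lam)]
    (h : IsGrowthFlow φ) (hk : IsKillingRate k) (hv : Measurable v) (hv0 : ∀ y, 0 ≤ v y)
    (hlam : 0 < lam) (hG : ∀ᵐ z ∂G, z ∈ Set.Ioc (0 : ℝ) 1)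
    (hV : ∀ y, 0 < y → value φ k v δ lam G y ≤ ENNReal.ofReal C) {y : ℝ} (hy : 0 < y) :
    value φ k v δ lam G y = ∫⁻ s in Set.Ioi 0,
      ENNReal.ofReal (Real.exp (-(lam + δ) * s - cumKill φ k y s)) *
        ENNReal.ofReal (source φ k v δ lam G (φ s y)) := by
  have hval : Measurable (value φ k v δ lam G) := measurable_value h hk hv
  have hpd : Measurable fun s => payDensity φ k v δ y s :=
    (measurable_payDensity h hk hv).comp measurable_prodMk_left
  have hcum : Measurable fun t => cumKill φ k y t :=
    (measurable_cumKill h hk).comp measurable_prodMk_left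
  have hflow : Measurable fun t => φ t y := h.measurable.comp measurable_prodMk_right
  have hA : Measurable fun t => ∫⁻ z, value φ k v δ lam G (z * φ t y) ∂G := by
    have : Measurable fun q : ℝ × ℝ => value φ k v δ lam G (q.2 * φ q.1 y) :=
      hval.comp (measurable_snd.mul (hflow.comp measurable_fst))
    exact this.lintegral_prod_right'
  have hstep : Measurable fun t => ENNReal.ofReal (Real.exp (-cumKill φ k y t - δ * t)) *
      ∫⁻ z, value φ k v δ lam G (z * φ t y) ∂G :=
    (Real.measurable_exp.comp (hcum.neg.sub (measurable_id.const_mul δ))).ennreal_ofReal.mul hA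
  have hfirst : Measurable fun s => ENNReal.ofReal (Real.exp (-(lam * s))) *
      payDensity φ k v δ y s :=
    (Real.measurable_exp.comp (measurable_id.const_mul lam).neg).ennreal_ofReal.mul hpd
  -- Both terms of the renewal equation become integrals over the same time variable with the same
  -- weight, and their densities add up to `source`.
  rw [value_eq h hk hv, firstPay_eq h hk hv hlam, stepOp, lintegral_expMeasure lam hstep,
    ← lintegral_add_left hfirst]
  refine setLIntegral_congr_fun measurableSet_Ioi fun s hs => ?_
  have hs0 : 0 ≤ s := le_of_lt hs
  have e1 : ENNReal.ofReal (Real.exp (-(lam * s))) *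
      ENNReal.ofReal (Real.exp (-cumKill φ k y s - δ * s))
      = ENNReal.ofReal (Real.exp (-(lam + δ) * s - cumKill φ k y s)) := by
    rw [← ENNReal.ofReal_mul (by positivity), ← Real.exp_add]
    ring_nf
  have e2 : ENNReal.ofReal (lam * Real.exp (-(lam * s))) *
      ENNReal.ofReal (Real.exp (-cumKill φ k y s - δ * s))
      = ENNReal.ofReal (Real.exp (-(lam + δ) * s - cumKill φ k y s)) * ENNReal.ofReal lam := by
    rw [ENNReal.ofReal_mul hlam.le, mul_assoc, e1, mul_comm]
  rw [ofReal_source h hk hv hv0 hlam hG hV (h.pos hy hs0), payDensity_eq hk hv0 hs0, mul_add,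
    ← mul_assoc, e1, ← mul_assoc, e2, mul_assoc _ (ENNReal.ofReal lam)]

theorem measurable_source [SFinite G] [SFinite (expMeasure lam)] (h : IsGrowthFlow φ)
    (hk : IsKillingRate k) (hv : Measurable v) : Measurable (source φ k v δ lam G) := by
  have h1 : Measurable fun q : ℝ × ℝ => (value φ k v δ lam G (q.2 * q.1)).toReal :=
    ((measurable_value h hk hv).comp (measurable_snd.mul measurable_fst)).ennreal_toReal
  have h2 : Measurable fun u => ∫ z, (value φ k v δ lam G (z * u)).toReal ∂G :=
    (h1.stronglyMeasurable.integral_prod_right').measurable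
  exact (hk.measurable.mul hv).add (h2.const_mul lam)

theorem source_nonneg (hk : IsKillingRate k) (hv0 : ∀ y, 0 ≤ v y) (hlam : 0 < lam) (u : ℝ) :
    0 ≤ source φ k v δ lam G u :=
  add_nonneg (mul_nonneg (hk.nonneg _) (hv0 _))
    (mul_nonneg hlam.le (integral_nonneg fun _ => ENNReal.toReal_nonneg))

/-- The source collected along the flow from `y`, discounted and weighted by survival (frozen for
negative times). -/
noncomputable def sourceAlong (φ : ℝ → ℝ → ℝ) (k q : ℝ → ℝ) (L y s : ℝ) : ℝ :=
  Real.exp (-L * s - cumKill φ k y s) * q (φ (max s 0) y)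

theorem measurable_sourceAlong {q : ℝ → ℝ} {L : ℝ} (h : IsGrowthFlow φ) (hk : IsKillingRate k)
    (hq : Measurable q) (y : ℝ) : Measurable (sourceAlong φ k q L y) := by
  have hcum : Measurable fun t => cumKill φ k y t :=
    (measurable_cumKill h hk).comp measurable_prodMk_left
  have hfl : Measurable fun t => φ (max t 0) y :=
    h.measurable.comp ((measurable_id.max measurable_const).prodMk measurable_const)
  exact (Real.measurable_exp.comp ((measurable_id.const_mul _).sub hcum)).mul (hq.comp hfl)

theorem locallyIntegrable_sourceAlong {q : ℝ → ℝ} {L D y : ℝ} (h : IsGrowthFlow φ)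
    (hk : IsKillingRate k) (hq : Measurable q) (hD : ∀ u, y ≤ u → |q u| ≤ D) (hy : 0 < y) :
    LocallyIntegrable (sourceAlong φ k q L y) volume := by
  have hcont : Continuous fun s => Real.exp (-L * s - cumKill φ k y s) :=
    Real.continuous_exp.comp ((continuous_const.mul continuous_id).sub (continuous_cumKill h hk hy))
  refine (hcont.mul (continuous_const (y := D))).locallyIntegrable.mono
    (measurable_sourceAlong h hk hq y).aestronglyMeasurable (ae_of_all _ fun s => ?_)
  have h1 := hD _ (h.le hy (le_max_right s 0))
  rw [sourceAlong, Pi.mul_apply, norm_mul, norm_mul]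
  refine mul_le_mul_of_nonneg_left ?_ (norm_nonneg _)
  rw [Real.norm_eq_abs, Real.norm_eq_abs]
  exact h1.trans (le_abs_self D)

/-- The rate may blow up at zero, but it is antitone: on `[y, ∞)` it is bounded by its value at `y`,
which is enough along a trajectory started at `y`. -/
theorem source_le [IsProbabilityMeasure G] (hk : IsKillingRate k) (hv0 : ∀ y, 0 ≤ v y)
    (hvC : ∀ y, v y ≤ C) (hlam : 0 < lam) (hG : ∀ᵐ z ∂G, z ∈ Set.Ioc (0 : ℝ) 1)
    (hV : ∀ y, 0 < y → value φ k v δ lam G y ≤ ENNReal.ofReal C) {y u : ℝ} (hy : 0 < y)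
    (hu : y ≤ u) : |source φ k v δ lam G u| ≤ k y * C + lam * C := by
  have hC : 0 ≤ C := (hv0 0).trans (hvC 0)
  rw [abs_of_nonneg (source_nonneg hk hv0 hlam u)]
  refine add_le_add ?_ (mul_le_mul_of_nonneg_left ?_ hlam.le)
  · exact mul_le_mul (hk.anti hy (hy.trans_le hu) hu) (hvC _) (hv0 _) (hk.nonneg _)
  · have h1 : ∫ z, (value φ k v δ lam G (z * u)).toReal ∂G ≤ ∫ _, C ∂G := by
      refine integral_mono_of_nonneg (ae_of_all _ fun _ => ENNReal.toReal_nonneg)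
        (integrable_const _) ?_
      filter_upwards [hG] with z hz
      exact ENNReal.toReal_le_of_le_ofReal hC (hV _ (mul_pos hz.1 (hy.trans_le hu)))
    simpa using h1

/-- Decomposition of the value at a deterministic time of the flow. -/
theorem value_flow [IsProbabilityMeasure G] [SFinite (expMeasure lam)]
    (h : IsGrowthFlow φ) (hk : IsKillingRate k) (hv : Measurable v) (hv0 : ∀ y, 0 ≤ v y)
    (hvC : ∀ y, v y ≤ C) (hlam : 0 < lam) (hG : ∀ᵐ z ∂G, z ∈ Set.Ioc (0 : ℝ) 1)
    (hV : ∀ y, 0 < y → value φ k v δ lam G y ≤ ENNReal.ofReal C) {y t : ℝ} (hy : 0 < y)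
    (ht : 0 ≤ t) :
    (value φ k v δ lam G y).toReal
      = (∫ s in (0 : ℝ)..t, sourceAlong φ k (source φ k v δ lam G) (lam + δ) y s)
        + Real.exp (-(lam + δ) * t - cumKill φ k y t) * (value φ k v δ lam G (φ t y)).toReal := by
  set q := source φ k v δ lam G with hq
  set f : ℝ → ℝ≥0∞ := fun s => ENNReal.ofReal (Real.exp (-(lam + δ) * s - cumKill φ k y s)) *
        ENNReal.ofReal (q (φ s y)) with hf
  have hsplit : value φ k v δ lam G y = (∫⁻ s in Set.Ioc 0 t, f s) + ∫⁻ s in Set.Ioi t, f s := by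
    rw [value_eq_lintegral h hk hv hv0 hlam hG hV hy, ← Set.Ioc_union_Ioi_eq_Ioi ht,
      lintegral_union measurableSet_Ioi (Set.Ioc_disjoint_Ioi le_rfl)]
  have hfirst : ∫⁻ s in Set.Ioc 0 t, f s
      = ENNReal.ofReal (∫ s in (0 : ℝ)..t, sourceAlong φ k q (lam + δ) y s) := by
    rw [intervalIntegral.integral_of_le ht, ofReal_integral_eq_lintegral_ofReal]
    · refine setLIntegral_congr_fun measurableSet_Ioc fun s hs => ?_
      simp only [hf, sourceAlong]
      rw [max_eq_left hs.1.le, ENNReal.ofReal_mul (Real.exp_pos _).le]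
    · exact ((locallyIntegrable_sourceAlong h hk (measurable_source h hk hv)
        (fun u hu => source_le hk hv0 hvC hlam hG hV hy hu) hy).integrableOn_isCompact
          isCompact_Icc).mono_set Set.Ioc_subset_Icc_self
    · exact ae_of_all _ fun s => mul_nonneg (Real.exp_pos _).le (source_nonneg hk hv0 hlam _)
  -- Shifting time by `t`, the semigroup law and the additivity of `cumKill` identify the tail with
  -- the weighted value at `φ t y`.
  have hsecond : ∫⁻ s in Set.Ioi t, f s
      = ENNReal.ofReal (Real.exp (-(lam + δ) * t - cumKill φ k y t)) *
        value φ k v δ lam G (φ t y) := by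
    have hcum : Measurable fun s => cumKill φ k (φ t y) s :=
      (measurable_cumKill h hk).comp measurable_prodMk_left
    have hqs : Measurable fun s => q (φ s (φ t y)) :=
      (measurable_source h hk hv).comp (h.measurable.comp measurable_prodMk_right)
    have hm : Measurable fun s =>
        ENNReal.ofReal (Real.exp (-(lam + δ) * s - cumKill φ k (φ t y) s)) *
          ENNReal.ofReal (q (φ s (φ t y))) :=
      (Real.measurable_exp.comp ((measurable_id.const_mul _).sub hcum)).ennreal_ofReal.mul
        hqs.ennreal_ofReal
    rw [value_eq_lintegral h hk hv hv0 hlam hG hV (h.pos hy ht), ← lintegral_const_mul _ hm,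
      ← lintegral_indicator measurableSet_Ioi, ← lintegral_indicator measurableSet_Ioi]
    refine (lintegral_add_right_eq_self _ t).symm.trans (lintegral_congr fun u => ?_)
    by_cases hu : 0 < u
    · rw [Set.indicator_of_mem (Set.mem_Ioi.2 (by linarith)),
        Set.indicator_of_mem (Set.mem_Ioi.2 hu), ← mul_assoc,
        ← ENNReal.ofReal_mul (Real.exp_pos _).le, ← Real.exp_add]
      simp only [hf]
      rw [add_comm u t, cumKill_add h hk hy ht hu.le, h.add t u y ht hu.le hy]
      congr 3
      ring
    · rw [Set.indicator_of_notMem (by simpa using hu),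
        Set.indicator_of_notMem (by simpa using hu)]
  have h1 : 0 ≤ ∫ s in (0 : ℝ)..t, sourceAlong φ k q (lam + δ) y s :=
    intervalIntegral.integral_nonneg ht fun s _ =>
      mul_nonneg (Real.exp_pos _).le (source_nonneg hk hv0 hlam _)
  rw [hsplit, hfirst, hsecond, ENNReal.toReal_add ENNReal.ofReal_ne_top
    (ENNReal.mul_ne_top ENNReal.ofReal_ne_top
      ((hV _ (h.pos hy ht)).trans_lt ENNReal.ofReal_lt_top).ne),
    ENNReal.toReal_ofReal h1, ENNReal.toReal_mul, ENNReal.toReal_ofReal (Real.exp_pos _).le]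

end Value

theorem IsInput.value_le {Ω : Type*} [MeasurableSpace Ω] {P : Measure Ω} [IsProbabilityMeasure P]
    {lam : ℝ} {G : Measure ℝ} [SFinite G] {W Z : ℕ → Ω → ℝ} {E : Ω → ℝ} {φ : ℝ → ℝ → ℝ}
    {k v : ℝ → ℝ} {δ C : ℝ} (hI : IsInput P lam G W Z E)
    (hG : ∀ᵐ z ∂G, z ∈ Set.Ioc (0 : ℝ) 1) (h : IsGrowthFlow φ) (hk : IsKillingRate k)
    (hv : Measurable v) (hvC : ∀ y, v y ≤ C) (hC : 0 ≤ C) (hδ : 0 ≤ δ) {y : ℝ} (hy : 0 < y) :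
    value φ k v δ lam G y ≤ ENNReal.ofReal C := by
  rw [← (hI.lintegral_penaltySum hG h hk hv hy).2]
  have : ∀ᵐ o ∂P, penaltySum φ k v δ (fun i => W i o) (fun i => Z i o) y (E o)
      ≤ ENNReal.ofReal C := by
    filter_upwards [hI.ae_W_pos, hI.ae_E_pos] with o hWo hEo
    have := penaltySum_le (φ := φ) (Z := fun i => Z i o) (x := y) hk hWo hδ hC hvC (N := 0) hEo
    simpa [Household.lossTime] using this
  exact (lintegral_mono_ae this).trans (by simp)

end KilledFlow

/-! ### Regularity of the value and its differential equation. -/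

namespace KilledFlow

/-- A coordinate `θ` in which the flow with velocity `b` is the translation by the time. -/
structure IsTimeCoord (φ : ℝ → ℝ → ℝ) (θ b : ℝ → ℝ) : Prop where
  flow : ∀ y t, 0 < y → 0 ≤ t → θ (φ t y) = θ y + t
  deriv : ∀ y, 0 < y → HasDerivAt θ (1 / b y) y
  pos : ∀ y, 0 < y → 0 < b y

section TimeCoord

variable {φ : ℝ → ℝ → ℝ} {θ b : ℝ → ℝ}

theorem IsTimeCoord.strictMonoOn (hθ : IsTimeCoord φ θ b) : StrictMonoOn θ (Set.Ioi 0) := by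
  refine strictMonoOn_of_deriv_pos (convex_Ioi 0)
    (fun y hy => (hθ.deriv y hy).continuousAt.continuousWithinAt) fun y hy => ?_
  rw [interior_Ioi] at hy
  rw [(hθ.deriv y hy).deriv]
  exact one_div_pos.2 (hθ.pos y hy)

/-- Every level above `y` is hit by the trajectory from `y`, at an explicit time that depends
smoothly on the level. -/
theorem IsTimeCoord.flow_sub (hθ : IsTimeCoord φ θ b) (h : IsGrowthFlow φ) {x y : ℝ} (hy : 0 < y)
    (hyx : y ≤ x) : 0 ≤ θ x - θ y ∧ φ (θ x - θ y) y = x := by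
  have hx : 0 < x := hy.trans_le hyx
  have h0 : 0 ≤ θ x - θ y := sub_nonneg.2 (hθ.strictMonoOn.monotoneOn hy hx hyx)
  refine ⟨h0, hθ.strictMonoOn.injOn (h.pos hy h0) hx ?_⟩
  rw [hθ.flow y _ hy h0]
  ring

end TimeCoord

section Regularity

variable {φ : ℝ → ℝ → ℝ} {θ b k q V : ℝ → ℝ} {L : ℝ}

/-- The value at time `t` of the flow from `y`, in terms of the value at `y`. -/
noncomputable def valueAlong (φ : ℝ → ℝ → ℝ) (k q V : ℝ → ℝ) (L y t : ℝ) : ℝ :=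
  Real.exp (L * t + cumKill φ k y t) * (V y - ∫ s in (0 : ℝ)..t, sourceAlong φ k q L y s)

theorem valueAlong_eq
    (hV : ∀ y t, 0 < y → 0 ≤ t → V y = (∫ s in (0 : ℝ)..t, sourceAlong φ k q L y s)
      + Real.exp (-L * t - cumKill φ k y t) * V (φ t y)) {y t : ℝ} (hy : 0 < y) (ht : 0 ≤ t) :
    valueAlong φ k q V L y t = V (φ t y) := by
  rw [valueAlong, hV y t hy ht, add_sub_cancel_left, ← mul_assoc, ← Real.exp_add]
  ring_nf
  simp

/-- All values above `y` are expressed through the one number `V y` and primitives in time, so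
regularity in the level reduces to regularity of those primitives. -/
theorem eq_valueAlong (hθ : IsTimeCoord φ θ b) (h : IsGrowthFlow φ)
    (hV : ∀ y t, 0 < y → 0 ≤ t → V y = (∫ s in (0 : ℝ)..t, sourceAlong φ k q L y s)
      + Real.exp (-L * t - cumKill φ k y t) * V (φ t y)) {x y : ℝ} (hy : 0 < y) (hyx : y ≤ x) :
    V x = valueAlong φ k q V L y (θ x - θ y) := by
  obtain ⟨h0, h1⟩ := hθ.flow_sub h hy hyx
  rw [valueAlong_eq hV hy h0, h1]

theorem continuous_valueAlong (h : IsGrowthFlow φ) (hk : IsKillingRate k) (hqm : Measurable q)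
    {y D : ℝ} (hy : 0 < y) (hD : ∀ u, y ≤ u → |q u| ≤ D) :
    Continuous (valueAlong φ k q V L y) := by
  have hli := locallyIntegrable_sourceAlong (L := L) h hk hqm hD hy
  exact (Real.continuous_exp.comp ((continuous_const.mul continuous_id).add
    (continuous_cumKill h hk hy))).mul (continuous_const.sub
      (intervalIntegral.continuous_primitive (fun a b =>
        (hli.integrableOn_isCompact isCompact_uIcc).intervalIntegrable) 0))

theorem continuousAt_of_valueAlong (hθ : IsTimeCoord φ θ b) (h : IsGrowthFlow φ)
    (hk : IsKillingRate k) (hqm : Measurable q) (hqb : ∀ y, 0 < y → ∃ D, ∀ u, y ≤ u → |q u| ≤ D)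
    (hV : ∀ y t, 0 < y → 0 ≤ t → V y = (∫ s in (0 : ℝ)..t, sourceAlong φ k q L y s)
      + Real.exp (-L * t - cumKill φ k y t) * V (φ t y)) {x : ℝ} (hx : 0 < x) :
    ContinuousAt V x := by
  -- Any starting level strictly between `0` and `x` would do: the trajectory must cover a
  -- neighbourhood of `x`.
  have hy : 0 < x / 2 := half_pos hx
  obtain ⟨D, hD⟩ := hqb _ hy
  have h1 : ContinuousAt (fun u => valueAlong φ k q V L (x / 2) (θ u - θ (x / 2))) x :=
    (continuous_valueAlong h hk hqm hy hD).continuousAt.comp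
      ((hθ.deriv x hx).continuousAt.sub continuousAt_const)
  refine h1.congr ?_
  filter_upwards [Ioi_mem_nhds (half_lt_self hx)] with u hu
  exact (eq_valueAlong hθ h hV hy (le_of_lt hu)).symm

/-- The exponential prefactor contributes the linear term; in the derivative of the integral it
cancels against the survival weight, leaving `-c`. -/
theorem hasDerivAt_valueAlong {y t κ c : ℝ} (hK : HasDerivAt (cumKill φ k y) κ t)
    (hS : HasDerivAt (fun t => ∫ s in (0 : ℝ)..t, sourceAlong φ k q L y s)
      (Real.exp (-L * t - cumKill φ k y t) * c) t) :
    HasDerivAt (valueAlong φ k q V L y) ((L + κ) * valueAlong φ k q V L y t - c) t := by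
  have h1 := ((((hasDerivAt_id t).const_mul L).add hK).exp).mul (hS.const_sub (V y))
  refine h1.congr_deriv ?_
  have h2 : Real.exp (L * t + cumKill φ k y t) * Real.exp (-L * t - cumKill φ k y t) = 1 := by
    rw [← Real.exp_add]
    ring_nf
    simp
  simp only [valueAlong, Pi.add_apply, id_eq, mul_one]
  linear_combination -c * h2

theorem hasDerivAt_of_along (hθ : IsTimeCoord φ θ b) (h : IsGrowthFlow φ)
    (hV : ∀ y t, 0 < y → 0 ≤ t → V y = (∫ s in (0 : ℝ)..t, sourceAlong φ k q L y s)
      + Real.exp (-L * t - cumKill φ k y t) * V (φ t y)) {x y κ c : ℝ} (hy : 0 < y) (hyx : y < x)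
    (hK : HasDerivAt (cumKill φ k y) κ (θ x - θ y))
    (hS : HasDerivAt (fun t => ∫ s in (0 : ℝ)..t, sourceAlong φ k q L y s)
      (Real.exp (-L * (θ x - θ y) - cumKill φ k y (θ x - θ y)) * c) (θ x - θ y)) :
    HasDerivAt V (((L + κ) * V x - c) / b x) x := by
  have h1 := (hasDerivAt_valueAlong (V := V) hK hS).comp x
    ((hθ.deriv x (hy.trans hyx)).sub_const (θ y))
  rw [← eq_valueAlong hθ h hV hy hyx.le, mul_one_div] at h1
  refine h1.congr_of_eventuallyEq ?_
  filter_upwards [Ioi_mem_nhds hyx] with u hu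
  exact eq_valueAlong hθ h hV hy (le_of_lt hu)

theorem hasDerivAt_of_continuousAt (hθ : IsTimeCoord φ θ b) (h : IsGrowthFlow φ)
    (hk : IsKillingRate k) (hqm : Measurable q) (hqb : ∀ y, 0 < y → ∃ D, ∀ u, y ≤ u → |q u| ≤ D)
    (hV : ∀ y t, 0 < y → 0 ≤ t → V y = (∫ s in (0 : ℝ)..t, sourceAlong φ k q L y s)
      + Real.exp (-L * t - cumKill φ k y t) * V (φ t y)) {x : ℝ} (hx : 0 < x)
    (hkc : ContinuousAt k x) (hqc : ContinuousAt q x) :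
    HasDerivAt V (((L + k x) * V x - q x) / b x) x := by
  have hy : 0 < x / 2 := half_pos hx
  have hyx := half_lt_self hx
  obtain ⟨D, hD⟩ := hqb _ hy
  obtain ⟨h0, h1⟩ := hθ.flow_sub h hy hyx.le
  set t := θ x - θ (x / 2) with ht
  have ht0 : 0 < t := sub_pos.2 (hθ.strictMonoOn hy hx hyx)
  have hφc : ContinuousAt (fun s => φ (max s 0) (x / 2)) t := by
    have h2 : ContinuousAt (fun s => φ s (x / 2)) t :=
      (h.cont _ hy).continuousAt (Ici_mem_nhds ht0)
    refine h2.congr ?_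
    filter_upwards [Ioi_mem_nhds ht0] with s hs
    rw [max_eq_left (le_of_lt hs)]
  have hφv : φ (max t 0) (x / 2) = x := by rw [max_eq_left h0, h1]
  have hrc : ContinuousAt (rateAlong φ k (x / 2)) t :=
    ContinuousAt.comp (f := fun s => φ (max s 0) (x / 2)) (g := k) (by rwa [hφv]) hφc
  have hsc : ContinuousAt (sourceAlong φ k q L (x / 2)) t :=
    ContinuousAt.mul (Real.continuous_exp.comp ((continuous_const.mul continuous_id).sub
      (continuous_cumKill h hk hy))).continuousAt
      (ContinuousAt.comp (f := fun s => φ (max s 0) (x / 2)) (g := q) (by rwa [hφv]) hφc)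
  have hK := hasDerivAt_cumKill h hk hy hrc
  rw [rateAlong, hφv] at hK
  have hli := locallyIntegrable_sourceAlong (L := L) h hk hqm hD hy
  have hS := intervalIntegral.integral_hasDerivAt_right 
    (hli.integrableOn_isCompact (isCompact_uIcc (a := 0) (b := t))).intervalIntegrable
    (measurable_sourceAlong h hk hqm _).stronglyMeasurable.stronglyMeasurableAtFilter hsc
  rw [sourceAlong, hφv] at hS
  exact hasDerivAt_of_along hθ h hV hy hyx hK hS

/-- The trajectory starts at `a` itself, so nothing is asked of `k` below `a`, where it may jump. At
`x = a` the time is `0`; freezing at negative times still makes `valueAlong` differentiable there,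
and restricting to levels `≥ a` gives a one-sided derivative. -/
theorem hasDerivWithinAt_Ici (hθ : IsTimeCoord φ θ b) (h : IsGrowthFlow φ)
    (hV : ∀ y t, 0 < y → 0 ≤ t → V y = (∫ s in (0 : ℝ)..t, sourceAlong φ k q L y s)
      + Real.exp (-L * t - cumKill φ k y t) * V (φ t y)) {a x : ℝ} (ha : 0 < a) (hax : a ≤ x)
    (hk0 : ∀ u, a ≤ u → k u = 0) (hqc : ContinuousOn q (Set.Ici a)) :
    HasDerivWithinAt V ((L * V x - q x) / b x) (Set.Ici a) x := by
  obtain ⟨h0, h1⟩ := hθ.flow_sub h ha hax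
  set t := θ x - θ a with ht
  have hcum : ∀ s, cumKill φ k a s = 0 := by
    intro s
    rw [cumKill]
    have : rateAlong φ k a = fun _ => 0 := by
      funext u
      exact hk0 _ (h.le ha (le_max_right _ _))
    rw [this]
    simp
  have hφc : Continuous fun s => φ (max s 0) a :=
    (h.cont a ha).comp_continuous (continuous_id.max continuous_const) fun s =>
      Set.mem_Ici.2 (le_max_right s 0)
  have hsc : Continuous (sourceAlong φ k q L a) := by
    have h2 : Continuous fun s => q (φ (max s 0) a) :=
      hqc.comp_continuous hφc fun s => h.le ha (le_max_right _ _)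
    have h3 : Continuous fun s => Real.exp (-L * s - cumKill φ k a s) := by
      simp only [hcum]
      fun_prop
    exact h3.mul h2
  have hK : HasDerivAt (cumKill φ k a) 0 t := by
    rw [show cumKill φ k a = fun _ => 0 from funext hcum]
    exact hasDerivAt_const _ _
  have hS := intervalIntegral.integral_hasDerivAt_right (hsc.intervalIntegrable 0 t)
    hsc.measurable.stronglyMeasurable.stronglyMeasurableAtFilter hsc.continuousAt
  rw [sourceAlong, max_eq_left h0, h1] at hS
  have h2 := (hasDerivAt_valueAlong (V := V) hK hS).comp x
    ((hθ.deriv x (ha.trans_le hax)).sub_const (θ a))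
  rw [ht, ← eq_valueAlong hθ h hV ha hax, mul_one_div, add_zero] at h2
  refine h2.hasDerivWithinAt.congr (fun u hu => eq_valueAlong hθ h hV ha hu)
    (eq_valueAlong hθ h hV ha hax)

/-- For a fixed start, Lebesgue differentiation excludes a null set of times only, and a
differentiable flow maps it to a null set of levels. The starts `1 / (n + 1)` exhaust the half-line.
-/
theorem ae_hasDerivAt (hθ : IsTimeCoord φ θ b) (h : IsGrowthFlow φ)
    (hdiff : ∀ y, 0 < y → DifferentiableOn ℝ (fun t => φ t y) (Set.Ici 0))
    (hk : IsKillingRate k) (hqm : Measurable q) (hqb : ∀ y, 0 < y → ∃ D, ∀ u, y ≤ u → |q u| ≤ D)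
    (hV : ∀ y t, 0 < y → 0 ≤ t → V y = (∫ s in (0 : ℝ)..t, sourceAlong φ k q L y s)
      + Real.exp (-L * t - cumKill φ k y t) * V (φ t y)) :
    ∀ᵐ x : ℝ, 0 < x → HasDerivAt V (((L + k x) * V x - q x) / b x) x := by
  have key : ∀ y, 0 < y → ∀ᵐ x : ℝ, y < x → HasDerivAt V (((L + k x) * V x - q x) / b x) x := by
    intro y hy
    obtain ⟨D, hD⟩ := hqb y hy
    have hli := locallyIntegrable_sourceAlong (L := L) h hk hqm hD hy
    have hlr : LocallyIntegrable (rateAlong φ k y) volume :=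
      (rateAlong_antitone h hk hy).locallyIntegrable
    have hae := (LocallyIntegrable.ae_hasDerivAt_integral hli).and
      (LocallyIntegrable.ae_hasDerivAt_integral hlr)
    rw [ae_iff] at hae
    set N := {t : ℝ | ¬((∀ c, HasDerivAt (fun x => ∫ s in c..x, sourceAlong φ k q L y s)
      (sourceAlong φ k q L y t) t) ∧ ∀ c, HasDerivAt (fun x => ∫ s in c..x, rateAlong φ k y s)
      (rateAlong φ k y t) t)} with hN
    have himg : volume ((fun t => φ t y) '' (N ∩ Set.Ici 0)) = 0 :=
      addHaar_image_eq_zero_of_differentiableOn_of_addHaar_eq_zero volume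
        ((hdiff y hy).mono Set.inter_subset_right)
        (measure_mono_null Set.inter_subset_left hae)
    rw [ae_iff]
    refine measure_mono_null (fun x hx => ?_) himg
    simp only [Set.mem_ofPred_eq, Classical.not_imp] at hx
    obtain ⟨hyx, hx⟩ := hx
    obtain ⟨h0, h1⟩ := hθ.flow_sub h hy hyx.le
    refine ⟨θ x - θ y, ⟨?_, h0⟩, h1⟩
    intro hgood
    refine hx (hasDerivAt_of_along hθ h hV hy hyx ?_ ?_)
    · have := hgood.2 0
      rwa [rateAlong, max_eq_left h0, h1] at this
    · have := hgood.1 0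
      rwa [sourceAlong, max_eq_left h0, h1] at this
  have hall : ∀ᵐ x : ℝ, ∀ n : ℕ, 1 / ((n : ℝ) + 1) < x →
      HasDerivAt V (((L + k x) * V x - q x) / b x) x :=
    ae_all_iff.2 fun n => key _ Nat.one_div_pos_of_nat
  filter_upwards [hall] with x hx hx0
  obtain ⟨n, hn⟩ := exists_nat_one_div_lt hx0
  exact hx n hn

theorem continuousOn_integral_mul {G : Measure ℝ} [IsProbabilityMeasure G] {C : ℝ}
    (hG : ∀ᵐ z ∂G, z ∈ Set.Ioc (0 : ℝ) 1) (hVm : Measurable V) (hVc : ∀ x, 0 < x → ContinuousAt V x)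
    (hVb : ∀ x, 0 < x → |V x| ≤ C) :
    ContinuousOn (fun u => ∫ z, V (z * u) ∂G) (Set.Ioi 0) := by
  intro u hu
  refine tendsto_integral_filter_of_dominated_convergence (fun _ => C) ?_ ?_ (integrable_const _) ?_
  · exact Eventually.of_forall fun u =>
      (hVm.comp (measurable_id.mul_const u)).aestronglyMeasurable
  · filter_upwards [self_mem_nhdsWithin] with u hu
    filter_upwards [hG] with z hz
    exact hVb _ (mul_pos hz.1 hu)
  · filter_upwards [hG] with z hz
    exact ContinuousAt.tendsto (ContinuousAt.comp (f := fun u => z * u) (hVc _ (mul_pos hz.1 hu))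
      (continuousAt_const.mul continuousAt_id)) |>.mono_left nhdsWithin_le_nhds

end Regularity

end KilledFlow

/-! ### The capital dynamics as a growth flow with a time coordinate. -/

namespace Household

open KilledFlow (IsGrowthFlow IsTimeCoord postLevel path)

/-- Time that the flow needs to go from level `1` to level `y`. -/
noncomputable def flowTime (r cT xs B y : ℝ) : ℝ := ∫ u in (1 : ℝ)..y, 1 / drift r cT xs B u

section Flow

variable {r cT xs B : ℝ}

/-- As `xs < B`, the two positive parts never vanish together. Hence `1 / drift` can be integrated
over any interval and `flowTime` is a strictly increasing coordinate. -/
theorem drift_pos (hr : 0 < r) (hc : 0 < cT) (hxB : xs < B) (y : ℝ) : 0 < drift r cT xs B y := by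
  rcases lt_or_ge xs y with h | h
  · have h1 : 0 < r * max (y - xs) 0 := mul_pos hr (lt_max_of_lt_left (sub_pos.2 h))
    have h2 : 0 ≤ cT * max (B - y) 0 := mul_nonneg hc.le (le_max_right _ _)
    exact add_pos_of_pos_of_nonneg h1 h2
  · have h1 : 0 ≤ r * max (y - xs) 0 := mul_nonneg hr.le (le_max_right _ _)
    have h2 : 0 < cT * max (B - y) 0 := mul_pos hc (lt_max_of_lt_left (by linarith))
    exact add_pos_of_nonneg_of_pos h1 h2

theorem continuous_drift : Continuous (drift r cT xs B) := by
  unfold drift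
  fun_prop

theorem mul_sub_le_drift (hr : 0 < r) (hc : 0 < cT) (y : ℝ) :
    r * (y - xs) ≤ drift r cT xs B y := by
  have h1 : r * (y - xs) ≤ r * max (y - xs) 0 := mul_le_mul_of_nonneg_left (le_max_left _ _) hr.le
  have h2 : 0 ≤ cT * max (B - y) 0 := mul_nonneg hc.le (le_max_right _ _)
  unfold drift
  linarith

theorem hasDerivAt_flowTime (hr : 0 < r) (hc : 0 < cT) (hxB : xs < B) (y : ℝ) :
    HasDerivAt (flowTime r cT xs B) (1 / drift r cT xs B y) y := by
  have hcont : Continuous fun u => 1 / drift r cT xs B u :=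
    continuous_const.div continuous_drift fun u => (drift_pos hr hc hxB u).ne'
  exact intervalIntegral.integral_hasDerivAt_right (hcont.intervalIntegrable _ _)
    hcont.measurable.stronglyMeasurable.stronglyMeasurableAtFilter hcont.continuousAt

theorem flowTime_strictMono (hr : 0 < r) (hc : 0 < cT) (hxB : xs < B) :
    StrictMono (flowTime r cT xs B) :=
  strictMono_of_deriv_pos fun y => by
    rw [(hasDerivAt_flowTime hr hc hxB y).deriv]
    exact one_div_pos.2 (drift_pos hr hc hxB y)

theorem flowTime_flow (hr : 0 < r) (hc : 0 < cT) (hrc : r ≠ cT) (hxB : xs < B) (y : ℝ) {t : ℝ}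
    (ht : 0 ≤ t) : flowTime r cT xs B (flow r cT xs B t y) = flowTime r cT xs B y + t := by
  have hd : ∀ s, 0 ≤ s → HasDerivAt
      (fun s => flowTime r cT xs B (flow r cT xs B s y) - s) 0 s := by
    intro s hs
    have h1 := ((hasDerivAt_flowTime hr hc hxB (flow r cT xs B s y)).comp s
      (hasDerivAt_flow hr hc hrc hxB y hs)).sub (hasDerivAt_id s)
    refine h1.congr_deriv ?_
    have := (drift_pos hr hc hxB (flow r cT xs B s y)).ne'
    field_simp
    simp
  have := constant_of_has_deriv_right_zero (a := 0) (b := t)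
    (fun s hs => (hd s hs.1).continuousAt.continuousWithinAt)
    (fun s hs => (hd s hs.1).hasDerivWithinAt) t ⟨ht, le_rfl⟩
  simp only [flow_zero hr hc hrc hxB, sub_zero] at this
  linarith

theorem flow_monotoneOn (hr : 0 < r) (hc : 0 < cT) (hrc : r ≠ cT) (hxB : xs < B) (y : ℝ) :
    MonotoneOn (fun t => flow r cT xs B t y) (Set.Ici 0) := by
  have hd := fun t (ht : t ∈ Set.Ici (0 : ℝ)) => hasDerivAt_flow hr hc hrc hxB y ht
  refine monotoneOn_of_deriv_nonneg (convex_Ici 0)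
    (fun t ht => (hd t ht).continuousAt.continuousWithinAt)
    (fun t ht => (hd t (interior_subset ht)).differentiableAt.differentiableWithinAt) ?_
  intro t ht
  rw [(hd t (interior_subset ht)).deriv]
  exact (drift_pos hr hc hxB _).le

/-- The drift dominates `r * (y - xs)` at every level, so `(X - xs) * exp (-r t)` increases along
the flow. This exponential growth drives the limit under net profit. -/
theorem growUp_le_flow (hr : 0 < r) (hc : 0 < cT) (hrc : r ≠ cT) (hxB : xs < B) (y : ℝ) {t : ℝ}
    (ht : 0 ≤ t) : growUp r xs t y ≤ flow r cT xs B t y := by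
  have hd : ∀ s ∈ Set.Ici (0 : ℝ), HasDerivAt
      (fun s => (flow r cT xs B s y - xs) * Real.exp (-r * s))
      ((drift r cT xs B (flow r cT xs B s y) - r * (flow r cT xs B s y - xs))
        * Real.exp (-r * s)) s := by
    intro s hs
    have h1 := ((hasDerivAt_flow hr hc hrc hxB y hs).sub_const xs).mul
      (((hasDerivAt_id s).const_mul (-r)).exp)
    refine h1.congr_deriv ?_
    simp only [id_eq]
    ring
  have hmono : MonotoneOn (fun s => (flow r cT xs B s y - xs) * Real.exp (-r * s))
      (Set.Ici 0) := by
    refine monotoneOn_of_deriv_nonneg (convex_Ici 0)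
      (fun t ht => (hd t ht).continuousAt.continuousWithinAt)
      (fun t ht => (hd t (interior_subset ht)).differentiableAt.differentiableWithinAt) ?_
    intro s hs
    rw [(hd s (interior_subset hs)).deriv]
    exact mul_nonneg (sub_nonneg.2 (mul_sub_le_drift hr hc _)) (Real.exp_pos _).le
  have h2 := hmono (Set.mem_Ici.2 le_rfl) (Set.mem_Ici.2 ht) ht
  simp only [flow_zero hr hc hrc hxB, mul_zero, Real.exp_zero, mul_one] at h2
  have h3 : Real.exp (-r * t) * Real.exp (r * t) = 1 := by
    rw [← Real.exp_add]
    ring_nf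
    simp
  have h4 := mul_le_mul_of_nonneg_right h2 (Real.exp_pos (r * t)).le
  rw [mul_assoc, h3] at h4
  unfold growUp
  linarith

theorem measurable_flow : Measurable fun p : ℝ × ℝ => flow r cT xs B p.1 p.2 := by
  have hB : Measurable fun p : ℝ × ℝ => timeToB r cT xs B p.2 := by
    unfold timeToB
    exact (Real.measurable_log.comp
      (measurable_const.div (measurable_snd.add_const _))).const_mul _
  have hX : Measurable fun p : ℝ × ℝ => timeToXs cT xs B p.2 := by
    unfold timeToXs
    exact (Real.measurable_log.comp
      (measurable_const.div (measurable_snd.sub_const _))).const_mul _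
  have hup : ∀ f g : ℝ × ℝ → ℝ, Measurable f → Measurable g →
      Measurable fun p => growUp r xs (f p) (g p) := by
    intro f g hf hg
    unfold growUp
    fun_prop
  have hmid : ∀ f g : ℝ × ℝ → ℝ, Measurable f → Measurable g →
      Measurable fun p => growMid r cT xs B (f p) (g p) := by
    intro f g hf hg
    unfold growMid
    fun_prop
  have hlow : Measurable fun p : ℝ × ℝ => growLow cT B p.1 p.2 := by
    unfold growLow
    fun_prop
  have hfmid : ∀ f g : ℝ × ℝ → ℝ, Measurable f → Measurable g →
      Measurable fun p => flowMid r cT xs B (f p) (g p) := by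
    intro f g hf hg
    have hBg : Measurable fun p => timeToB r cT xs B (g p) :=
      hB.comp ((measurable_const (a := (0 : ℝ))).prodMk hg)
    exact Measurable.ite (measurableSet_le hf hBg) (hmid f g hf hg)
      (hup _ _ (hf.sub hBg) measurable_const)
  unfold flow
  refine Measurable.ite (measurableSet_le measurable_const measurable_snd)
    (hup _ _ measurable_fst measurable_snd)
    (Measurable.ite (measurableSet_le measurable_const measurable_snd)
      (hfmid _ _ measurable_fst measurable_snd) ?_)
  unfold flowLow
  exact Measurable.ite (measurableSet_le measurable_fst hX) hlow
    (hfmid _ _ (measurable_fst.sub hX) measurable_const)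

theorem isGrowthFlow_flow (hr : 0 < r) (hc : 0 < cT) (hrc : r ≠ cT) (hxB : xs < B) :
    IsGrowthFlow (flow r cT xs B) where
  measurable := measurable_flow
  zero y _ := flow_zero hr hc hrc hxB y
  -- The semigroup law needs no case distinction over the regions: both sides have the same time
  -- coordinate, which is injective.
  add s t y hs ht _ := by
    refine (flowTime_strictMono hr hc hxB).injective ?_
    rw [flowTime_flow hr hc hrc hxB _ (add_nonneg hs ht), flowTime_flow hr hc hrc hxB _ ht,
      flowTime_flow hr hc hrc hxB _ hs, add_assoc]
  mono y _ := flow_monotoneOn hr hc hrc hxB y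
  cont y _ t ht := (hasDerivAt_flow hr hc hrc hxB y ht).continuousAt.continuousWithinAt

theorem isTimeCoord_flowTime (hr : 0 < r) (hc : 0 < cT) (hrc : r ≠ cT) (hxB : xs < B) :
    IsTimeCoord (flow r cT xs B) (flowTime r cT xs B) (drift r cT xs B) where
  flow y _ _ ht := flowTime_flow hr hc hrc hxB y ht
  deriv y _ := hasDerivAt_flowTime hr hc hxB y
  pos y _ := drift_pos hr hc hxB y

theorem postLoss_eq (W Z : ℕ → ℝ) (x : ℝ) (n : ℕ) :
    postLoss r cT xs B W Z x n = postLevel (flow r cT xs B) W Z x n := by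
  induction n with
  | zero => rfl
  | succ n ih => rw [postLoss, postLevel, ih]

theorem capital_eq_path (W Z : ℕ → ℝ) (x : ℝ) :
    capital r cT xs B W Z x = path (flow r cT xs B) W Z x := by
  funext t
  rw [capital, path, postLoss_eq]

end Flow

end Household

/-! ### Laws of large numbers and paths with large initial capital. -/

namespace KilledFlow

open Household (lossTime)

theorem integral_id_expMeasure {lam : ℝ} (hlam : 0 < lam) :
    Integrable id (expMeasure lam) ∧ ∫ t, t ∂(expMeasure lam) = 1 / lam := by
  have h1 : ∫ t in Set.Ioi 0, lam * Real.exp (-(lam * t)) * t = 1 / lam := by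
    have h := Real.integral_rpow_mul_exp_neg_mul_Ioi (a := 2) (r := lam) two_pos hlam
    norm_num at h
    have h2 : ∀ t : ℝ, lam * Real.exp (-(lam * t)) * t = lam * (t * Real.exp (-(lam * t))) :=
      fun t => by ring
    simp only [h2]
    rw [integral_const_mul, h]
    field_simp
  have hint : IntegrableOn (fun t => lam * Real.exp (-(lam * t)) * t) (Set.Ioi 0) := by
    -- A non-integrable function has integral `0` by convention, while this integral equals `1 /
    -- lam`.
    by_contra hcon
    rw [integral_undef hcon] at h1
    exact (one_div_pos.2 hlam).ne h1
  have hnn : ∀ᵐ t ∂volume.restrict (Set.Ioi (0 : ℝ)), 0 ≤ lam * Real.exp (-(lam * t)) * t := by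
    filter_upwards [ae_restrict_mem measurableSet_Ioi] with t ht
    have : 0 < t := ht
    positivity
  have h2 : ∫⁻ t, ENNReal.ofReal t ∂(expMeasure lam) = ENNReal.ofReal (1 / lam) := by
    rw [lintegral_expMeasure lam ENNReal.measurable_ofReal, ← h1,
      ofReal_integral_eq_lintegral_ofReal hint hnn]
    refine lintegral_congr fun t => ?_
    rw [ENNReal.ofReal_mul (by positivity : 0 ≤ lam * Real.exp (-(lam * t)))]
  have hnn2 : 0 ≤ᵐ[expMeasure lam] id :=
    (ae_expMeasure_pos lam).mono fun t ht => ht.le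
  refine ⟨⟨measurable_id.aestronglyMeasurable, ?_⟩, ?_⟩
  · rw [hasFiniteIntegral_iff_ofReal hnn2]
    simp only [id_eq]
    rw [h2]
    exact ENNReal.ofReal_lt_top
  · refine (integral_eq_lintegral_of_nonneg_ae hnn2 measurable_id.aestronglyMeasurable).trans ?_
    simp only [id_eq]
    rw [h2, ENNReal.toReal_ofReal (one_div_pos.2 hlam).le]

section Laws

variable {Ω : Type*} [mΩ : MeasurableSpace Ω] {P : Measure Ω} {lam : ℝ} {G : Measure ℝ}
  {W Z : ℕ → Ω → ℝ} {E : Ω → ℝ}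

theorem IsInput.ae_tendsto_lossTime_div (hI : IsInput P lam G W Z E) (hlam : 0 < lam) :
    ∀ᵐ o ∂P, Tendsto (fun n : ℕ => lossTime (fun i => W i o) n / n) atTop (𝓝 (1 / lam)) := by
  obtain ⟨h1, h2⟩ := integral_id_expMeasure hlam
  have hident : ∀ i, IdentDistrib (W i) (W 0) P P := fun i =>
    ⟨(hI.measurable_W i).aemeasurable, (hI.measurable_W 0).aemeasurable, by
      rw [hI.map_W, hI.map_W]⟩
  have hint : Integrable (W 0) P := by
    rw [← hI.map_W 0] at h1
    exact h1.comp_measurable (hI.measurable_W 0)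
  have hmean : ∫ o, W 0 o ∂P = 1 / lam := by
    rw [← h2, ← hI.map_W 0, integral_map (hI.measurable_W 0).aemeasurable
      measurable_id'.aestronglyMeasurable]
  have := strong_law_ae_real W hint (fun i j hij => hI.indep.indepFun (i := Sum.inl i)
    (j := Sum.inl j) (by simpa using hij)) hident
  rw [hmean] at this
  exact this

/-- Losses do not accumulate, so almost surely every time belongs to a loss interval. -/
theorem IsInput.ae_tendsto_lossTime (hI : IsInput P lam G W Z E) (hlam : 0 < lam) :
    ∀ᵐ o ∂P, Tendsto (lossTime fun i => W i o) atTop atTop := by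
  filter_upwards [hI.ae_tendsto_lossTime_div hlam] with o ho
  have h1 := (ho.pos_mul_atTop (one_div_pos.2 hlam) tendsto_natCast_atTop_atTop)
  refine h1.congr' ?_
  filter_upwards [eventually_gt_atTop 0] with n hn
  have : (n : ℝ) ≠ 0 := by positivity
  field_simp

theorem IsInput.ae_tendsto_log_div (hI : IsInput P lam G W Z E) (hlog : Integrable Real.log G) :
    ∀ᵐ o ∂P, Tendsto (fun n : ℕ => (∑ i ∈ Finset.range n, Real.log (Z i o)) / n) atTop
      (𝓝 (∫ z, Real.log z ∂G)) := by
  have hm : ∀ i, Measurable fun o => Real.log (Z i o) := fun i =>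
    Real.measurable_log.comp (hI.measurable_Z i)
  have hident0 : ∀ i, IdentDistrib (Z i) (Z 0) P P := fun i =>
    ⟨(hI.measurable_Z i).aemeasurable, (hI.measurable_Z 0).aemeasurable, by
      rw [hI.map_Z, hI.map_Z]⟩
  have hint : Integrable (fun o => Real.log (Z 0 o)) P := by
    rw [← hI.map_Z 0] at hlog
    exact hlog.comp_measurable (hI.measurable_Z 0)
  have hmean : ∫ o, Real.log (Z 0 o) ∂P = ∫ z, Real.log z ∂G := by
    rw [← hI.map_Z 0, integral_map (hI.measurable_Z 0).aemeasurable
      Real.measurable_log.aestronglyMeasurable]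
  have := strong_law_ae_real (fun i o => Real.log (Z i o)) hint
    (fun i j hij => (hI.indep.indepFun (i := Sum.inr (Sum.inl i)) (j := Sum.inr (Sum.inl j))
      (by simpa using hij)).comp Real.measurable_log Real.measurable_log)
    (fun i => (hident0 i).comp Real.measurable_log)
  rwa [hmean] at this

end Laws

section Limit

variable {φ : ℝ → ℝ → ℝ} {k v : ℝ → ℝ} {δ C a r : ℝ} {W Z : ℕ → ℝ}

/-- The level only falls at losses: if it is at least `a` after each of them, it is so throughout,
where the rate is zero. -/
theorem killAt_eq_zero (h : IsGrowthFlow φ) (ha : 0 < a) (hk0 : ∀ u, a ≤ u → k u = 0) {x : ℝ}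
    {N : ℕ} (hN : ∀ i < N, a ≤ postLevel φ W Z x i) : killAt φ k W Z x N = 0 := by
  induction N with
  | zero => rfl
  | succ N ih =>
    have h1 : a ≤ postLevel φ W Z x N := hN N (Nat.lt_succ_self N)
    have h2 : rateAlong φ k (postLevel φ W Z x N) = fun _ => 0 := by
      funext u
      exact hk0 _ (h1.trans (h.le (ha.trans_le h1) (le_max_right _ _)))
    rw [killAt_succ, ih fun i hi => hN i (Nat.lt_succ_of_lt hi), cumKill, h2]
    simp

theorem mul_prod_le_postLevel (h : IsGrowthFlow φ) (hW : ∀ n, 0 < W n) (hZ : ∀ n, 0 < Z n) {x : ℝ}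
    (hx : 0 < x) (n : ℕ) : x * ∏ i ∈ Finset.range n, Z i ≤ postLevel φ W Z x n := by
  induction n with
  | zero => simp [postLevel]
  | succ n ih =>
    rw [Finset.prod_range_succ, postLevel, ← mul_assoc, mul_comm]
    exact mul_le_mul_of_nonneg_left (ih.trans (h.le (postLevel_pos h hW hZ hx n) (hW n).le))
      (hZ n).le

theorem tendsto_postLevel (h : IsGrowthFlow φ) (hW : ∀ n, 0 < W n) (hZ : ∀ n, 0 < Z n) (n : ℕ) :
    Tendsto (fun x => postLevel φ W Z x n) atTop atTop := by
  refine tendsto_atTop_mono' atTop ?_ (tendsto_id.atTop_mul_const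
    (Finset.prod_pos (s := Finset.range n) fun i _ => hZ i))
  filter_upwards [eventually_gt_atTop 0] with x hx using mul_prod_le_postLevel h hW hZ hx n

/-- With discounting, the payoff along a path vanishes for large initial levels. -/
theorem tendsto_penaltySum_of_discount (h : IsGrowthFlow φ) (hk : IsKillingRate k) (ha : 0 < a)
    (hk0 : ∀ u, a ≤ u → k u = 0) (hW : ∀ n, 0 < W n) (hZ : ∀ n, 0 < Z n)
    (hT : Tendsto (lossTime W) atTop atTop) (hδ : 0 < δ) (hC : 0 ≤ C) (hv : ∀ y, v y ≤ C) {e : ℝ}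
    (he : 0 < e) :
    Tendsto (fun x => (penaltySum φ k v δ W Z x e).toReal) atTop (𝓝 0) := by
  have hlim : Tendsto (fun n => Real.exp (-δ * lossTime W n) * C) atTop (𝓝 0) := by
    have h1 : Tendsto (fun n => -δ * lossTime W n) atTop atBot :=
      hT.const_mul_atTop_of_neg (neg_neg_of_pos hδ)
    simpa using (Real.tendsto_exp_atBot.comp h1).mul_const C
  rw [Metric.tendsto_nhds]
  intro ε hε
  -- `N` is chosen first, from the discount factor alone; then `x` is taken so large that the levels
  -- of the first `N` loss intervals stay above `a` and cause no killing.
  obtain ⟨N, hN⟩ := (hlim.eventually_lt_const hε).exists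
  have hev : ∀ᶠ x in atTop, ∀ i ∈ Finset.range N, a ≤ postLevel φ W Z x i :=
    (Finset.range N).eventually_all.2 fun i _ =>
      (tendsto_postLevel h hW hZ i).eventually_ge_atTop a
  filter_upwards [hev] with x hx
  have h0 : killAt φ k W Z x N = 0 :=
    killAt_eq_zero h ha hk0 fun i hi => hx i (Finset.mem_range.2 hi)
  have h1 := penaltySum_le (v := v) (δ := δ) hk hW hδ.le hC hv (N := N) (h0.trans_lt he)
  rw [Real.dist_0_eq_abs, abs_of_nonneg ENNReal.toReal_nonneg]
  exact (ENNReal.toReal_le_of_le_ofReal (by positivity) h1).trans_lt hN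

/-- Unrolling `Y (n+1) ≥ Z n * exp (r * W n) * (Y n - a)`: with `S` the partial sums of `r * W i +
log (Z i)`, each step loses `a * exp (-S n)` inside the bracket. -/
theorem exp_mul_le_postLevel (h : IsGrowthFlow φ) (ha : 0 ≤ a)
    (hgrow : ∀ y t, 0 < y → 0 ≤ t → (y - a) * Real.exp (r * t) + a ≤ φ t y)
    (hW : ∀ n, 0 < W n) (hZ : ∀ n, 0 < Z n) {x : ℝ} (hx : 0 < x) (n : ℕ) :
    Real.exp (∑ i ∈ Finset.range n, (r * W i + Real.log (Z i))) *
      (x - a * ∑ j ∈ Finset.range n,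
        Real.exp (-∑ i ∈ Finset.range j, (r * W i + Real.log (Z i)))) ≤ postLevel φ W Z x n := by
  induction n with
  | zero => simp [postLevel]
  | succ n ih =>
    set S := ∑ i ∈ Finset.range n, (r * W i + Real.log (Z i)) with hS
    set M := ∑ j ∈ Finset.range n,
        Real.exp (-∑ i ∈ Finset.range j, (r * W i + Real.log (Z i))) with hM
    set Y := postLevel φ W Z x n with hY
    have hYpos : 0 < Y := postLevel_pos h hW hZ hx n
    have h1 : Real.exp S * Real.exp (-S) = 1 := by rw [← Real.exp_add]; simp
    have h2 : Real.exp S * (x - a * (M + Real.exp (-S))) ≤ Y - a := by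
      have : Real.exp S * (x - a * (M + Real.exp (-S)))
          = Real.exp S * (x - a * M) - a * (Real.exp S * Real.exp (-S)) := by ring
      rw [this, h1]
      linarith
    have h3 : (Y - a) * Real.exp (r * W n) ≤ φ (W n) Y :=
      le_trans (le_add_of_nonneg_right ha) (hgrow Y (W n) hYpos (hW n).le)
    rw [Finset.sum_range_succ, Finset.sum_range_succ, ← hS, ← hM, postLevel, ← hY,
      Real.exp_add, Real.exp_add, Real.exp_log (hZ n)]
    calc Real.exp S * (Real.exp (r * W n) * Z n) * (x - a * (M + Real.exp (-S)))
        = Z n * ((Real.exp S * (x - a * (M + Real.exp (-S)))) * Real.exp (r * W n)) := by ring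
      _ ≤ Z n * ((Y - a) * Real.exp (r * W n)) := by
          have := (hZ n).le
          gcongr
      _ ≤ Z n * φ (W n) Y := mul_le_mul_of_nonneg_left h3 (hZ n).le

/-- Under positive mean growth, a path that starts high enough never goes below `a`. -/
theorem eventually_forall_le_postLevel (h : IsGrowthFlow φ) (ha : 0 < a)
    (hgrow : ∀ y t, 0 < y → 0 ≤ t → (y - a) * Real.exp (r * t) + a ≤ φ t y)
    (hW : ∀ n, 0 < W n) (hZ : ∀ n, 0 < Z n) {μ : ℝ} (hμ : 0 < μ)
    (hS : Tendsto (fun n : ℕ => (∑ i ∈ Finset.range n, (r * W i + Real.log (Z i))) / n) atTop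
      (𝓝 μ)) :
    ∀ᶠ x in atTop, ∀ n, a ≤ postLevel φ W Z x n := by
  set S : ℕ → ℝ := fun n => ∑ i ∈ Finset.range n, (r * W i + Real.log (Z i)) with hSdef
  -- Eventually `S n ≥ n * μ / 2`, so a geometric series dominates.
  have hsum : Summable fun n => Real.exp (-S n) := by
    have hgeo : Summable fun n : ℕ => Real.exp (-(μ / 2)) ^ n :=
      summable_geometric_of_lt_one (Real.exp_pos _).le (Real.exp_lt_one_iff.2 (by linarith))
    refine Summable.of_norm_bounded_eventually_nat hgeo ?_
    filter_upwards [hS.eventually_const_lt (half_lt_self hμ), eventually_gt_atTop 0] with n hn hn0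
    have hn1 : (0 : ℝ) < n := Nat.cast_pos.2 hn0
    rw [lt_div_iff₀ hn1] at hn
    rw [Real.norm_eq_abs, Real.abs_exp, ← Real.exp_nat_mul]
    refine Real.exp_le_exp.2 ?_
    linarith
  set M := ∑' n, Real.exp (-S n) with hM
  have hMle : ∀ n, Real.exp (-S n) ≤ M := fun n =>
    hsum.le_tsum n fun _ _ => (Real.exp_pos _).le
  have hMpos : 0 < M := (Real.exp_pos _).trans_le (hMle 0)
  -- Of the threshold `2 * a * M`, one half absorbs the subtracted sum; the other half, multiplied
  -- by `exp (S n)`, is at least `a` because `exp (-S n) ≤ M`.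
  filter_upwards [eventually_ge_atTop (2 * a * M), eventually_gt_atTop 0] with x hx hx0 n
  refine le_trans ?_ (exp_mul_le_postLevel h ha.le hgrow hW hZ hx0 n)
  have h1 : ∑ j ∈ Finset.range n, Real.exp (-S j) ≤ M :=
    hsum.sum_le_tsum _ fun _ _ => (Real.exp_pos _).le
  have h2 : a * M ≤ x - a * ∑ j ∈ Finset.range n, Real.exp (-S j) := by
    have := mul_le_mul_of_nonneg_left h1 ha.le
    linarith
  have h3 : 1 ≤ Real.exp (S n) * M := by
    have := mul_le_mul_of_nonneg_left (hMle n) (Real.exp_pos (S n)).le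
    rwa [← Real.exp_add, add_neg_cancel, Real.exp_zero] at this
  calc a ≤ a * (Real.exp (S n) * M) := le_mul_of_one_le_right ha.le h3
    _ = Real.exp (S n) * (a * M) := by ring
    _ ≤ _ := mul_le_mul_of_nonneg_left h2 (Real.exp_pos _).le

theorem tendsto_penaltySum_of_growth (h : IsGrowthFlow φ) (ha : 0 < a)
    (hk0 : ∀ u, a ≤ u → k u = 0)
    (hgrow : ∀ y t, 0 < y → 0 ≤ t → (y - a) * Real.exp (r * t) + a ≤ φ t y)
    (hW : ∀ n, 0 < W n) (hZ : ∀ n, 0 < Z n) {μ : ℝ} (hμ : 0 < μ)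
    (hS : Tendsto (fun n : ℕ => (∑ i ∈ Finset.range n, (r * W i + Real.log (Z i))) / n) atTop
      (𝓝 μ)) {e : ℝ} (he : 0 < e) :
    Tendsto (fun x => (penaltySum φ k v δ W Z x e).toReal) atTop (𝓝 0) := by
  refine tendsto_const_nhds.congr' ?_
  filter_upwards [eventually_forall_le_postLevel h ha hgrow hW hZ hμ hS] with x hx
  rw [penaltySum_eq_zero fun n => ?_, ENNReal.toReal_zero]
  rw [killAt_eq_zero h ha hk0 fun i _ => hx i]
  exact he

end Limit

end KilledFlow

/-! ### Translation of the model into the abstract setting. -/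

namespace Household

open KilledFlow

/-- The extreme poverty rate as a function of a positive capital. -/
noncomputable def killRate (xs : ℝ) (omega : ℝ → ℝ) (y : ℝ) : ℝ :=
  if 0 < y ∧ y < xs then omega y else 0

/-- The penalty as a function of a positive capital. -/
noncomputable def payoff (xs : ℝ) (w : ℝ → ℝ → ℝ) (y : ℝ) : ℝ :=
  if 0 < y ∧ y < xs then w y (xs - y) else 0

section Coefficients

variable {xs : ℝ} {omega : ℝ → ℝ} {w : ℝ → ℝ → ℝ}

theorem isKillingRate_killRate (homega0 : ∀ x ∈ Set.Ioc 0 xs, 0 ≤ omega x)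
    (homega : AntitoneOn omega (Set.Ioc 0 xs)) : IsKillingRate (killRate xs omega) := by
  have hnn : ∀ y, 0 ≤ killRate xs omega y := by
    intro y
    unfold killRate
    split_ifs with h
    · exact homega0 y ⟨h.1, h.2.le⟩
    · exact le_rfl
  have hanti : AntitoneOn (killRate xs omega) (Set.Ioi 0) := by
    intro y hy z hz hyz
    by_cases hzx : z < xs
    · rw [killRate, killRate, if_pos ⟨hz, hzx⟩, if_pos ⟨hy, hyz.trans_lt hzx⟩]
      exact homega ⟨hy, hyz.trans hzx.le⟩ ⟨hz, hzx.le⟩ hyz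
    · rw [killRate, if_neg fun h => hzx h.2]
      exact hnn y
  refine ⟨measurable_of_Ioi fun a => ?_, hnn, hanti⟩
  rcases lt_or_ge a 0 with ha | ha
  · convert MeasurableSet.univ
    exact Set.eq_univ_of_forall fun y => ha.trans_le (hnn y)
  · have hpos : ∀ y, a < killRate xs omega y → 0 < y := by
      intro y hy
      by_contra hneg
      rw [killRate, if_neg fun h => hneg h.1] at hy
      linarith
    -- For `a ≥ 0` the superlevel set lies in the positive half-line, where the rate is antitone, so
    -- it is an interval.
    refine Set.OrdConnected.measurableSet ⟨fun y hy z hz u hu => ?_⟩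
    have hu0 : 0 < u := (hpos y hy).trans_le hu.1
    exact lt_of_lt_of_le hz (hanti hu0 (hpos z hz) hu.2)

theorem ite_omega_eq_killRate {y : ℝ} (hy : 0 < y) :
    (if y < xs then omega y else 0) = killRate xs omega y := by
  simp [killRate, hy]

theorem killRate_of_le {y : ℝ} (hy : xs ≤ y) : killRate xs omega y = 0 :=
  if_neg fun h => absurd h.2 (not_lt.2 hy)

theorem measurable_payoff (hwm : Measurable (Function.uncurry w)) :
    Measurable (payoff xs w) :=
  Measurable.ite ((measurableSet_lt measurable_const measurable_id).inter
    (measurableSet_lt measurable_id measurable_const))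
    (hwm.comp (measurable_id.prodMk (measurable_const.sub measurable_id))) measurable_const

theorem payoff_nonneg (hw0 : ∀ x₁ ∈ Set.Ioo 0 xs, ∀ x₂ ∈ Set.Ioo 0 xs, 0 ≤ w x₁ x₂) (y : ℝ) :
    0 ≤ payoff xs w y := by
  unfold payoff
  split_ifs with h
  · exact hw0 y h _ ⟨by linarith [h.2], by linarith [h.1]⟩
  · exact le_rfl

theorem payoff_le {C : ℝ} (hC : 0 ≤ C)
    (hw : ∀ x₁ ∈ Set.Ioo 0 xs, ∀ x₂ ∈ Set.Ioo 0 xs, w x₁ x₂ ≤ C) (y : ℝ) :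
    payoff xs w y ≤ C := by
  unfold payoff
  split_ifs with h
  · exact hw y h _ ⟨by linarith [h.2], by linarith [h.1]⟩
  · exact hC

end Coefficients

/-- The inputs of the model agree almost surely with measurable ones. -/
theorem IsModelInput.exists_isInput {Ω : Type*} [MeasurableSpace Ω] {P : Measure Ω} {lam : ℝ}
    {G : Measure ℝ} {W Z : ℕ → Ω → ℝ} {E : Ω → ℝ} (hmodel : IsModelInput P lam G W Z E) :
    ∃ (W' Z' : ℕ → Ω → ℝ) (E' : Ω → ℝ), IsInput P lam G W' Z' E' ∧
      ∀ᵐ o ∂P, (∀ n, W n o = W' n o) ∧ (∀ n, Z n o = Z' n o) ∧ E o = E' o := by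
  have hW := fun n => (hmodel.law_W n).aemeasurable
  have hZ := fun n => (hmodel.law_Z n).aemeasurable
  have hE := hmodel.law_E.aemeasurable
  refine ⟨fun n => (hW n).mk, fun n => (hZ n).mk, hE.mk, ⟨fun n => (hW n).measurable_mk,
    fun n => (hZ n).measurable_mk, hE.measurable_mk, fun n => ?_, fun n => ?_, ?_, ?_⟩, ?_⟩
  · rw [← Measure.map_congr (hW n).ae_eq_mk, (hmodel.law_W n).map_eq]
  · rw [← Measure.map_congr (hZ n).ae_eq_mk, (hmodel.law_Z n).map_eq]
  · rw [← Measure.map_congr hE.ae_eq_mk, hmodel.law_E.map_eq]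
  · refine iIndepFun.congr (fun i => ?_) hmodel.indep
    rcases i with i | i | i
    · exact (hW i).ae_eq_mk
    · exact (hZ i).ae_eq_mk
    · exact hE.ae_eq_mk
  · filter_upwards [ae_all_iff.2 fun n => (hW n).ae_eq_mk, ae_all_iff.2 fun n => (hZ n).ae_eq_mk,
      hE.ae_eq_mk] with o h1 h2 h3 using ⟨h1, h2, h3⟩

section Expectation

variable {Ω : Type*} [MeasurableSpace Ω] {P : Measure Ω}
  {r cT xs B lam delta : ℝ} {G : Measure ℝ} {omega : ℝ → ℝ}
  {w : ℝ → ℝ → ℝ} {W Z W' Z' : ℕ → Ω → ℝ} {E E' : Ω → ℝ}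

/-- All null sets are discarded here: non-measurable versions of the inputs, non-positive inputs,
accumulating losses and ties. -/
theorem penaltyVar_ae_eq [IsProbabilityMeasure P] (hr : 0 < r) (hcT : 0 < cT) (hrc : r ≠ cT) (hB : xs < B) (hlam : 0 < lam)
    (hG : ∀ᵐ z ∂G, z ∈ Set.Ioc (0 : ℝ) 1) (hk : IsKillingRate (killRate xs omega))
    (hw0 : ∀ x₁ ∈ Set.Ioo 0 xs, ∀ x₂ ∈ Set.Ioo 0 xs, 0 ≤ w x₁ x₂)
    (hI : IsInput P lam G W' Z' E')
    (hae : ∀ᵐ o ∂P, (∀ n, W n o = W' n o) ∧ (∀ n, Z n o = Z' n o) ∧ E o = E' o) {x : ℝ}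
    (hx : 0 < x) :
    penaltyVar r cT xs B delta omega w W Z E x =ᵐ[P] fun o =>
      (penaltySum (flow r cT xs B) (killRate xs omega) (payoff xs w) delta (fun i => W' i o)
        (fun i => Z' i o) x (E' o)).toReal := by
  have h := isGrowthFlow_flow hr hcT hrc hB
  filter_upwards [hae, hI.ae_W_pos, hI.ae_Z_mem hG, hI.ae_E_pos, hI.ae_ne_killAt h hk x,
    hI.ae_tendsto_lossTime hlam] with o ho hWo hZo hEo hne hT
  simp only [penaltyVar, ho.1, ho.2.1, ho.2.2, capital_eq_path]
  exact discountedPenalty_path h hk (fun y hy => ite_omega_eq_killRate hy) (payoff_nonneg hw0)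
    (fun y hy => if_pos hy) hWo (fun n => (hZo n).1) hT hx hEo hne

theorem penaltySum_ae_le (hk : IsKillingRate (killRate xs omega)) {C : ℝ} (hC : 0 ≤ C)
    (hw : ∀ x₁ ∈ Set.Ioo 0 xs, ∀ x₂ ∈ Set.Ioo 0 xs, w x₁ x₂ ≤ C) (hdelta : 0 ≤ delta)
    (hI : IsInput P lam G W Z E) (φ : ℝ → ℝ → ℝ) (x : ℝ) :
    ∀ᵐ o ∂P, penaltySum φ (killRate xs omega) (payoff xs w) delta (fun i => W i o)
      (fun i => Z i o) x (E o) ≤ ENNReal.ofReal C := by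
  filter_upwards [hI.ae_W_pos, hI.ae_E_pos] with o hWo hEo
  have := penaltySum_le (φ := φ) (Z := fun i => Z i o) (x := x) hk hWo hdelta hC
    (payoff_le hC hw) (N := 0) hEo
  simpa [lossTime] using this

end Expectation

theorem setIntegral_Ioo_add_Icc {G : Measure ℝ} {f : ℝ → ℝ} (hf : Integrable f G) {a : ℝ}
    (ha : 0 < a) (ha1 : a ≤ 1) :
    (∫ z in Set.Ioo 0 a, f z ∂G) + ∫ z in Set.Icc a 1, f z ∂G = ∫ z in Set.Ioc 0 1, f z ∂G := by
  rw [← setIntegral_union _ measurableSet_Icc hf.integrableOn hf.integrableOn,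
    Set.Ioo_union_Icc_eq_Ioc ha ha1]
  exact Set.disjoint_left.2 fun z hz hz' => absurd hz.2 (not_lt.2 hz'.1)

theorem setIntegral_Ico_add_Icc {G : Measure ℝ} {f : ℝ → ℝ} (hf : Integrable f G) {a b c : ℝ}
    (hab : a ≤ b) (hbc : b ≤ c) :
    (∫ z in Set.Ico a b, f z ∂G) + ∫ z in Set.Icc b c, f z ∂G = ∫ z in Set.Icc a c, f z ∂G := by
  rw [← setIntegral_union _ measurableSet_Icc hf.integrableOn hf.integrableOn,
    Set.Ico_union_Icc_eq_Icc hab hbc]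
  exact Set.disjoint_left.2 fun z hz hz' => absurd hz.2 (not_lt.2 hz'.1)

end Household

/-! ### The integro-differential equations and the boundary conditions. -/

theorem theorem4p2 {Ω : Type*} [MeasurableSpace Ω] (P : Measure Ω) [IsProbabilityMeasure P]
    (r cT xs B lam delta : ℝ)
    (hr : 0 < r) (hcT : 0 < cT) (hrc : r ≠ cT) (hxs : 0 < xs) (hB : xs < B)
    (hlam : 0 < lam) (hdelta : 0 ≤ delta)
    -- the law of the remaining proportions, carried by `(0, 1]`
    (G : Measure ℝ) [IsProbabilityMeasure G] (hG : ∀ᵐ z ∂G, z ∈ Set.Ioc (0 : ℝ) 1)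
    -- the extreme poverty rate function on `(0, x*]`
    (omega : ℝ → ℝ) (homega0 : ∀ x ∈ Set.Ioc 0 xs, 0 ≤ omega x)
    (homega : AntitoneOn omega (Set.Ioc 0 xs))
    -- the penalty function
    (w : ℝ → ℝ → ℝ) (hwm : Measurable (Function.uncurry w))
    (hw0 : ∀ x₁ ∈ Set.Ioo 0 xs, ∀ x₂ ∈ Set.Ioo 0 xs, 0 ≤ w x₁ x₂)
    (hwb : ∃ C : ℝ, ∀ x₁ ∈ Set.Ioo 0 xs, ∀ x₂ ∈ Set.Ioo 0 xs, w x₁ x₂ ≤ C)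
    (W Z : ℕ → Ω → ℝ) (E : Ω → ℝ) (hmodel : Household.IsModelInput P lam G W Z E)
    -- the expected discounted penalty function
    (m : ℝ → ℝ)
    (hm : ∀ x, 0 < x →
      m x = ∫ o, Household.penaltyVar r cT xs B delta omega w W Z E x o ∂P) :
    -- all the expectations and integrals below are those of integrable functions
    (∀ x, 0 < x → Integrable (Household.penaltyVar r cT xs B delta omega w W Z E x) P) ∧
    (∀ x, 0 < x → Integrable (fun z => m (x * z)) G) ∧
    -- the equation for `x ≥ B` (one-sided derivative at `B`)
    (∀ x ∈ Set.Ici B, DifferentiableWithinAt ℝ m (Set.Ici B) x ∧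
      r * (x - xs) * derivWithin m (Set.Ici B) x - (lam + delta) * m x
        + lam * ((∫ z in Set.Ioo 0 (xs / x), m (x * z) ∂G)
          + (∫ z in Set.Ico (xs / x) (B / x), m (x * z) ∂G)
          + ∫ z in Set.Icc (B / x) 1, m (x * z) ∂G) = 0) ∧
    -- the equation for `x* ≤ x < B` (one-sided derivative at `x*`)
    (∀ x ∈ Set.Ico xs B, DifferentiableWithinAt ℝ m (Set.Ico xs B) x ∧
      (r - cT) * (x + Household.xss r cT xs B) * derivWithin m (Set.Ico xs B) x
        - (lam + delta) * m x
        + lam * ((∫ z in Set.Ioo 0 (xs / x), m (x * z) ∂G)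
          + ∫ z in Set.Icc (xs / x) 1, m (x * z) ∂G) = 0) ∧
    -- the equation for `0 < x < x*`, wherever its data are continuous ...
    (∀ x ∈ Set.Ioo 0 xs, ContinuousAt omega x → ContinuousAt (fun v => w v (xs - v)) x →
      DifferentiableAt ℝ m x ∧
      cT * (x - B) * deriv m x + (lam + delta + omega x) * m x - omega x * w x (xs - x)
        - lam * ∫ z in Set.Ioc 0 1, m (x * z) ∂G = 0) ∧
    -- ... and almost everywhere
    (∀ᵐ x : ℝ, x ∈ Set.Ioo 0 xs →
      DifferentiableAt ℝ m x ∧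
      cT * (x - B) * deriv m x + (lam + delta + omega x) * m x - omega x * w x (xs - x)
        - lam * ∫ z in Set.Ioc 0 1, m (x * z) ∂G = 0) ∧
    -- boundary conditions
    Tendsto m (𝓝[<] B) (𝓝 (m B)) ∧
    Tendsto m (𝓝[<] xs) (𝓝 (m xs)) ∧
    (0 < delta ∨
        (Integrable Real.log G ∧ lam * ∫ z, -Real.log z ∂G < r) →
      Tendsto m atTop (𝓝 0)) := by
  obtain ⟨C₀, hC₀⟩ := hwb
  set C := max C₀ 0 with hCdef
  have hC : 0 ≤ C := le_max_right _ _
  have hw : ∀ x₁ ∈ Set.Ioo 0 xs, ∀ x₂ ∈ Set.Ioo 0 xs, w x₁ x₂ ≤ C :=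
    fun x₁ h₁ x₂ h₂ => (hC₀ x₁ h₁ x₂ h₂).trans (le_max_left _ _)
  set φ := Household.flow r cT xs B with hφ
  set k := Household.killRate xs omega with hkdef
  set v := Household.payoff xs w with hvdef
  have h : KilledFlow.IsGrowthFlow φ := Household.isGrowthFlow_flow hr hcT hrc hB
  have hθ := Household.isTimeCoord_flowTime hr hcT hrc hB
  have hk : KilledFlow.IsKillingRate k := Household.isKillingRate_killRate homega0 homega
  have hk0 : ∀ u, xs ≤ u → k u = 0 := fun u hu => Household.killRate_of_le hu
  have hv : Measurable v := Household.measurable_payoff hwm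
  have hv0 : ∀ y, 0 ≤ v y := Household.payoff_nonneg hw0
  have hvC : ∀ y, v y ≤ C := Household.payoff_le hC hw
  obtain ⟨W', Z', E', hI, hae⟩ := hmodel.exists_isInput
  have : IsProbabilityMeasure (expMeasure lam) := isProbabilityMeasure_expMeasure hlam
  set D : ℝ → Ω → ℝ≥0∞ := fun x o =>
    KilledFlow.penaltySum φ k v delta (fun i => W' i o) (fun i => Z' i o) x (E' o) with hD
  have hDm : ∀ x, 0 < x → Measurable (D x) := fun x hx =>
    (hI.lintegral_penaltySum hG h hk hv hx).1
  have hDle : ∀ x, ∀ᵐ o ∂P, D x o ≤ ENNReal.ofReal C := fun x =>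
    Household.penaltySum_ae_le hk hC hw hdelta hI φ x
  have hDi : ∀ x, 0 < x → Integrable (fun o => (D x o).toReal) P := by
    intro x hx
    refine (integrable_const C).mono' (hDm x hx).ennreal_toReal.aestronglyMeasurable ?_
    filter_upwards [hDle x] with o ho
    rw [Real.norm_eq_abs, abs_of_nonneg ENNReal.toReal_nonneg]
    exact ENNReal.toReal_le_of_le_ofReal hC ho
  have hvar : ∀ x, 0 < x → Household.penaltyVar r cT xs B delta omega w W Z E x =ᵐ[P]
      fun o => (D x o).toReal := fun x hx =>
    Household.penaltyVar_ae_eq hr hcT hrc hB hlam hG hk hw0 hI hae hx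
  have hmD : ∀ x, 0 < x → m x = ∫ o, (D x o).toReal ∂P := fun x hx => by
    rw [hm x hx, integral_congr_ae (hvar x hx)]
  set V : ℝ → ℝ := fun x => (KilledFlow.value φ k v delta lam G x).toReal with hVdef
  have hmV : ∀ x, 0 < x → m x = V x := fun x hx => by
    rw [hmD x hx, integral_toReal (hDm x hx).aemeasurable
      ((hDle x).mono fun o ho => ho.trans_lt ENNReal.ofReal_lt_top),
      (hI.lintegral_penaltySum hG h hk hv hx).2]
  have hval : ∀ y, 0 < y → KilledFlow.value φ k v delta lam G y ≤ ENNReal.ofReal C :=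
    fun y hy => hI.value_le hG h hk hv hvC hC hdelta hy
  have hVb : ∀ y, 0 < y → |V y| ≤ C := fun y hy => by
    rw [abs_of_nonneg ENNReal.toReal_nonneg]
    exact ENNReal.toReal_le_of_le_ofReal hC (hval y hy)
  have hVm : Measurable V := (KilledFlow.measurable_value h hk hv).ennreal_toReal
  set q := KilledFlow.source φ k v delta lam G with hq
  have hqm : Measurable q := KilledFlow.measurable_source h hk hv
  have hqb : ∀ y, 0 < y → ∃ D, ∀ u, y ≤ u → |q u| ≤ D := fun y hy =>
    ⟨_, fun u hu => KilledFlow.source_le hk hv0 hvC hlam hG hval hy hu⟩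
  have hflow : ∀ y t, 0 < y → 0 ≤ t →
      V y = (∫ s in (0 : ℝ)..t, KilledFlow.sourceAlong φ k q (lam + delta) y s)
        + Real.exp (-(lam + delta) * t - KilledFlow.cumKill φ k y t) * V (φ t y) :=
    fun y t hy ht => KilledFlow.value_flow h hk hv hv0 hvC hlam hG hval hy ht
  have hVc : ∀ x, 0 < x → ContinuousAt V x := fun x hx =>
    KilledFlow.continuousAt_of_valueAlong hθ h hk hqm hqb hflow hx
  have hAc : ContinuousOn (fun u => ∫ z, V (z * u) ∂G) (Set.Ioi 0) :=
    KilledFlow.continuousOn_integral_mul hG hVm hVc hVb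
  have hqx : ∀ u, q u = k u * v u + lam * ∫ z, V (z * u) ∂G := fun u => rfl
  have hVi : ∀ x, 0 < x → Integrable (fun z => V (z * x)) G := by
    intro x hx
    refine (integrable_const C).mono' (hVm.comp (measurable_id.mul_const x)).aestronglyMeasurable ?_
    filter_upwards [hG] with z hz using hVb _ (mul_pos hz.1 hx)
  have hmz : ∀ x, 0 < x → (fun z => m (x * z)) =ᵐ[G] fun z => V (z * x) := by
    intro x hx
    filter_upwards [hG] with z hz
    rw [hmV _ (mul_pos hx hz.1), mul_comm]
  have hmi : ∀ x, 0 < x → Integrable (fun z => m (x * z)) G := fun x hx =>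
    (hVi x hx).congr (hmz x hx).symm
  have hmA : ∀ x, 0 < x → ∫ z in Set.Ioc 0 1, m (x * z) ∂G = ∫ z, V (z * x) ∂G := by
    intro x hx
    rw [← integral_congr_ae (hmz x hx), Measure.restrict_eq_self_of_ae_mem hG]
  -- Nothing is known about `m` at non-positive arguments, so regularity is transferred from `V`
  -- locally.
  have hnear : ∀ x, 0 < x → m =ᶠ[𝓝 x] V := fun x hx => by
    filter_upwards [Ioi_mem_nhds hx] with u hu using hmV u hu
  -- One statement on `[xs, ∞)` serves both upper equations: restricting the set yields the
  -- one-sided derivatives at `xs` and at `B`, and the split integrals are reassembled over `(0,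
  -- 1]`.
  have hupper : ∀ x, xs ≤ x → HasDerivWithinAt m
      (((lam + delta) * m x - lam * ∫ z in Set.Ioc 0 1, m (x * z) ∂G)
        / Household.drift r cT xs B x) (Set.Ici xs) x := by
    intro x hx
    have hx0 : 0 < x := hxs.trans_le hx
    have hqc : ContinuousOn q (Set.Ici xs) := by
      refine ContinuousOn.congr (f := fun u => lam * ∫ z, V (z * u) ∂G) ?_ fun u hu => ?_
      · exact continuousOn_const.mul (hAc.mono fun u hu => hxs.trans_le hu)
      · rw [hqx, hk0 u hu]
        ring
    have h1 := KilledFlow.hasDerivWithinAt_Ici hθ h hflow hxs hx hk0 hqc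
    rw [hqx, hk0 x hx, zero_mul, zero_add, ← hmA x hx0, ← hmV x hx0] at h1
    exact h1.congr (fun u hu => hmV u (hxs.trans_le hu)) (hmV x hx0)
  have hdrift := fun x => (Household.drift_pos hr hcT hB x).ne'
  have hlower : ∀ x ∈ Set.Ioo 0 xs,
      HasDerivAt V (((lam + delta + k x) * V x - q x) / Household.drift r cT xs B x) x →
      DifferentiableAt ℝ m x ∧
      cT * (x - B) * deriv m x + (lam + delta + omega x) * m x - omega x * w x (xs - x)
        - lam * ∫ z in Set.Ioc 0 1, m (x * z) ∂G = 0 := by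
    intro x hx hder
    have h1 := hder.congr_of_eventuallyEq (hnear x hx.1)
    have hkx : k x = omega x := if_pos hx
    have hvx : v x = w x (xs - x) := if_pos hx
    have hd := hdrift x
    refine ⟨h1.differentiableAt, ?_⟩
    rw [h1.deriv, hmA x hx.1, hmV x hx.1, hqx, hkx, hvx]
    rw [Household.drift_of_le hB hx.2.le] at hd ⊢
    have hc : cT * (x - B) = -(cT * (B - x)) := by ring
    rw [hc, neg_mul, mul_div_cancel₀ _ hd]
    ring
  refine ⟨fun x hx => (hDi x hx).congr (hvar x hx).symm, hmi, fun x hx => ?_, fun x hx => ?_,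
    fun x hx hωc hwc => ?_, ?_, ?_, ?_, fun hcond => ?_⟩
  · have hx : B ≤ x := hx
    have hxs' : xs ≤ x := hB.le.trans hx
    have hx0 : 0 < x := hxs.trans_le hxs'
    have h1 := (hupper x hxs').mono (Set.Ici_subset_Ici.2 hB.le)
    refine ⟨h1.differentiableWithinAt, ?_⟩
    rw [h1.derivWithin (uniqueDiffOn_Ici B x hx), add_assoc (∫ z in Set.Ioo 0 (xs / x), _ ∂G),
      Household.setIntegral_Ico_add_Icc (hmi x hx0) (div_le_div_of_nonneg_right hB.le hx0.le)
        ((div_le_one hx0).2 hx),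
      Household.setIntegral_Ioo_add_Icc (hmi x hx0) (div_pos hxs hx0) ((div_le_one hx0).2 hxs'),
      ← Household.drift_of_ge (cT := cT) hB hx, mul_div_cancel₀ _ (hdrift x)]
    ring
  · have hx0 : 0 < x := hxs.trans_le hx.1
    have h1 := (hupper x hx.1).mono (Set.Ico_subset_Ici_self : Set.Ico xs B ⊆ Set.Ici xs)
    refine ⟨h1.differentiableWithinAt, ?_⟩
    rw [h1.derivWithin (uniqueDiffOn_Ico xs B x hx),
      Household.setIntegral_Ioo_add_Icc (hmi x hx0) (div_pos hxs hx0) ((div_le_one hx0).2 hx.1),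
      Household.mul_add_xss hrc, ← Household.drift_of_mid hx.1 hx.2.le,
      mul_div_cancel₀ _ (hdrift x)]
    ring
  · have hnhds : Set.Ioo 0 xs ∈ 𝓝 x := Ioo_mem_nhds hx.1 hx.2
    -- Inside `(0, xs)` the extensions by zero agree with the data near `x`, so continuity carries
    -- over.
    have hkc : ContinuousAt k x := hωc.congr (by
      filter_upwards [hnhds] with u hu using (if_pos hu).symm)
    have hvc : ContinuousAt v x := hwc.congr (by
      filter_upwards [hnhds] with u hu using (if_pos hu).symm)
    have hqc : ContinuousAt q x :=
      (hkc.mul hvc).add (continuousAt_const.mul (hAc.continuousAt (Ioi_mem_nhds hx.1)))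
    exact hlower x hx (KilledFlow.hasDerivAt_of_continuousAt hθ h hk hqm hqb hflow hx.1 hkc hqc)
  · have hdiff : ∀ y, 0 < y → DifferentiableOn ℝ (fun t => φ t y) (Set.Ici 0) := fun y _ t ht =>
      (Household.hasDerivAt_flow hr hcT hrc hB y ht).differentiableAt.differentiableWithinAt
    filter_upwards [KilledFlow.ae_hasDerivAt hθ h hdiff hk hqm hqb hflow] with x hx hxm
    exact hlower x hxm (hx hxm.1)
  · exact ((hVc B (hxs.trans hB)).congr (hnear B (hxs.trans hB)).symm).tendsto.mono_left
      nhdsWithin_le_nhds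
  · exact ((hVc xs hxs).congr (hnear xs hxs).symm).tendsto.mono_left nhdsWithin_le_nhds
  · have hpath : ∀ᵐ o ∂P, Tendsto (fun x => (D x o).toReal) atTop (𝓝 0) := by
      rcases hcond with hδ | ⟨hlog, hnet⟩
      · filter_upwards [hI.ae_W_pos, hI.ae_Z_mem hG, hI.ae_E_pos, hI.ae_tendsto_lossTime hlam]
          with o hWo hZo hEo hT
        exact KilledFlow.tendsto_penaltySum_of_discount h hk hxs hk0 hWo (fun n => (hZo n).1) hT
          hδ hC hvC hEo
      · filter_upwards [hI.ae_W_pos, hI.ae_Z_mem hG, hI.ae_E_pos,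
          hI.ae_tendsto_lossTime_div hlam, hI.ae_tendsto_log_div hlog] with o hWo hZo hEo hT hL
        rw [integral_neg] at hnet
        -- The mean step of the random walk `r * W i + log (Z i)`; the net profit condition says
        -- exactly that it is positive.
        have hμ : 0 < r * (1 / lam) + ∫ z, Real.log z ∂G := by
          have h1 : lam * (r * (1 / lam) + ∫ z, Real.log z ∂G) = r + lam * ∫ z, Real.log z ∂G := by
            field_simp
          have h2 : 0 < lam * (r * (1 / lam) + ∫ z, Real.log z ∂G) := by
            rw [h1]
            linarith
          exact (mul_pos_iff_of_pos_left hlam).1 h2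
        refine KilledFlow.tendsto_penaltySum_of_growth h hxs hk0
          (fun y t _ ht => Household.growUp_le_flow hr hcT hrc hB y ht) hWo (fun n => (hZo n).1)
          hμ (((hT.const_mul r).add hL).congr fun n => ?_) hEo
        rw [Household.lossTime, Finset.sum_add_distrib, ← Finset.mul_sum]
        ring
    -- How large `x` must be depends on the path, so the convergence is only pathwise; the constant
    -- `C` dominates.
    have hlim := tendsto_integral_filter_of_dominated_convergence (μ := P) (l := (atTop : Filter ℝ))
      (F := fun x o => (D x o).toReal) (f := fun _ => 0) (fun _ => C)
      (by filter_upwards [eventually_gt_atTop 0] with x hx using (hDi x hx).aestronglyMeasurable)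
      (Eventually.of_forall fun x => by
        filter_upwards [hDle x] with o ho
        rw [Real.norm_eq_abs, abs_of_nonneg ENNReal.toReal_nonneg]
        exact ENNReal.toReal_le_of_le_ofReal hC ho)
      (integrable_const C) hpath
    rw [integral_zero] at hlim
    refine hlim.congr' ?_
    filter_upwards [eventually_gt_atTop 0] with x hx using (hmD x hx).symm
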